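/- Let $\mathbb{A}$ be a finite abelian group with $d=|\mathbb{A}|$ elements, identified with $\{0,1,\dots,d-1\}$ by an arbitrary bijection under which the neutral element corresponds to $0$. Let $\mathbb{G}$ be the group of all sequences $(a_k)_{k\in\mathbb{Z}}$ in $\mathbb{A}$ that vanish for all sufficiently large $k$, with coordinatewise addition, let $\mathbb{R}_+=[0,\infty)$, and put $$\iota:\mathbb{G}\to\mathbb{R}_+,\quad \iota\big((a_k)_k\big)=\sum_{k\in\mathbb{Z}}a_kd^k,\qquad \kappa:\mathbb{R}_+\to\mathbb{G},\quad \kappa(t)=\big(\lfloor d^{-k}t\rfloor \bmod d\big)_{k\in\mathbb{Z}},\qquad x\oplus y:=\iota\big(\kappa(x)+\kappa(y)\big)\quad(x,y\in\mathbb{R}_+).$$ For bounded Borel functions $F,G:\mathbb{R}_+^2\to\mathbb{C}$, each supported in a bounded rectangle, and $k\in\mathbb{Z}$, let $$\mathrm{A}_k(F,G)(x,y):=d^k\int_{[0,d^{-k})}F(x\oplus t,y)\,G(x,y\oplus t)\,dt .$$ **Proposition.** For every real $p$ with $2\le p<\infty$ there is a finite constant $C_p$, depending only on $p$ (and not on $\mathbb{A}$,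 the identification, $F$, $G$, $m$ or the $k_j$), such that for all $\mathbb{A},F,G$ as above, every positive integer $m$ and all integers $k_0<k_1<\cdots<k_m$, $$\sum_{j=0}^{m-1}\big\|\mathrm{A}_{k_{j+1}}(F,G)-\mathrm{A}_{k_j}(F,G)\big\|_{L^p(\mathbb{R}_+^2)}^p\le C_p\,\|F\|_{L^{2p}(\mathbb{R}_+^2)}^p\,\|G\|_{L^{2p}(\mathbb{R}_+^2)}^p,$$ where the norms are taken with respect to Lebesgue measure on $\mathbb{R}_+^2$. -/

import Mathlib

open MeasureTheory
open scoped NNReal ENNReal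

noncomputable section

/-- Lebesgue measure on the half-line `[0, ∞)`. -/
def halfLineVolume : Measure ℝ≥0 :=
  (volume : Measure ℝ).comap ((↑) : ℝ≥0 → ℝ)

instance sigmaFinite_halfLineVolume : SigmaFinite halfLineVolume := by
  have he : MeasurableEmbedding ((↑) : ℝ≥0 → ℝ) :=
    MeasurableEmbedding.subtype_coe measurableSet_Ici
  refine SigmaFinite.of_map _ he.measurable.aemeasurable ?_
  rw [halfLineVolume, he.map_comap]
  infer_instance

/-- Lebesgue measure on the quarter-plane `[0, ∞)²`. -/
def quarterPlaneVolume : Measure (ℝ≥0 × ℝ≥0) :=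
  halfLineVolume.prod halfLineVolume

/-- An identification of a finite abelian group `A` with the digits `{0, 1, …, d - 1}`,
`d = |A|`, arbitrary except that the neutral element corresponds to the digit `0`. -/
structure DigitLabelling (A : Type*) [AddCommGroup A] [Finite A] where
  toEquiv : A ≃ Fin (Nat.card A)
  map_zero : (toEquiv 0 : ℕ) = 0

namespace CantorGroup

variable (A : Type*) [AddCommGroup A]

/-- The group `𝔾` of two-sided sequences in `A` that vanish at all large indices,
with coordinatewise addition. -/
def seqGroup : AddSubgroup (ℤ → A) where
  carrier := {a | ∃ k₀ : ℤ, ∀ k, k₀ < k → a k = 0}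
  zero_mem' := ⟨0, fun _ _ => rfl⟩
  add_mem' := by
    rintro a b ⟨k₀, ha⟩ ⟨l₀, hb⟩
    refine ⟨max k₀ l₀, fun k hk => ?_⟩
    rw [Pi.add_apply, ha k (lt_of_le_of_lt (le_max_left _ _) hk),
      hb k (lt_of_le_of_lt (le_max_right _ _) hk), add_zero]
  neg_mem' := by
    rintro a ⟨k₀, ha⟩
    exact ⟨k₀, fun k hk => by rw [Pi.neg_apply, ha k hk, neg_zero]⟩

variable {A} [Finite A]

/-- `ι (a) = ∑_k a_k d^k`. -/
def iota (e : DigitLabelling A) (a : seqGroup A) : ℝ≥0 :=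
  ∑' k : ℤ, (((e.toEquiv ((a : ℤ → A) k) : ℕ) : ℝ≥0)) * (Nat.card A : ℝ≥0) ^ k

/-- The element of `A` labelled by the `k`-th digit `⌊d^{-k} t⌋ mod d` of `t`. -/
def digit (e : DigitLabelling A) (t : ℝ≥0) (k : ℤ) : A :=
  e.toEquiv.symm
    ⟨⌊(Nat.card A : ℝ≥0) ^ (-k) * t⌋₊ % Nat.card A, Nat.mod_lt _ Nat.card_pos⟩

theorem digit_eq_zero_of_mod_eq_zero (e : DigitLabelling A) (t : ℝ≥0) (k : ℤ)
    (h : ⌊(Nat.card A : ℝ≥0) ^ (-k) * t⌋₊ % Nat.card A = 0) : digit e t k = 0 := by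
  rw [digit, Equiv.symm_apply_eq]
  ext
  rw [e.map_zero]
  exact h

theorem digit_mem_seqGroup (e : DigitLabelling A) (t : ℝ≥0) : digit e t ∈ seqGroup A := by
  rcases (Nat.one_le_iff_ne_zero.mpr (Nat.card_pos (α := A)).ne').eq_or_lt with h | h
  · exact ⟨0, fun k _ => digit_eq_zero_of_mod_eq_zero e t k (by rw [← h]; exact Nat.mod_one _)⟩
  · have h1 : (1 : ℝ≥0) < (Nat.card A : ℝ≥0) := by exact_mod_cast h
    obtain ⟨n, hn⟩ := pow_unbounded_of_one_lt t h1
    refine ⟨n, fun k hk => digit_eq_zero_of_mod_eq_zero e t k ?_⟩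
    have h2 : t < (Nat.card A : ℝ≥0) ^ k := by
      refine hn.trans_le ?_
      rw [← zpow_natCast]
      exact zpow_le_zpow_right₀ h1.le hk.le
    have h3 : (Nat.card A : ℝ≥0) ^ (-k) * t < 1 := by
      rw [zpow_neg, ← div_eq_inv_mul]
      exact (div_lt_one (lt_of_le_of_lt (zero_le) h2)).mpr h2
    rw [Nat.floor_eq_zero.mpr h3, Nat.zero_mod]

/-- `κ (t) = (⌊d^{-k} t⌋ mod d)_k`. -/
def kappa (e : DigitLabelling A) (t : ℝ≥0) : seqGroup A :=
  ⟨digit e t, digit_mem_seqGroup e t⟩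

/-- Digitwise addition `x ⊕ y = ι (κ (x) + κ (y))`. -/
def oplus (e : DigitLabelling A) (x y : ℝ≥0) : ℝ≥0 :=
  iota e (kappa e x + kappa e y)

/-- `A_k(F, G)(x, y) = d^k ∫_{[0, d^{-k})} F(x ⊕ t, y) G(x, y ⊕ t) dt`. -/
def bilinearAverage (e : DigitLabelling A) (k : ℤ) (F G : ℝ≥0 × ℝ≥0 → ℂ) (z : ℝ≥0 × ℝ≥0) : ℂ :=
  (Nat.card A : ℂ) ^ k *
    ∫ t in Set.Ico (0 : ℝ≥0) ((Nat.card A : ℝ≥0) ^ (-k)),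
      F (oplus e z.1 t, z.2) * G (z.1, oplus e z.2 t) ∂halfLineVolume

end CantorGroup

end

/-!
Functions on `ℝ≥0 × ℝ≥0` that vanish off `[0, dⁿ)²` and depend only on the digits of the coordinates
in positions `≥ -n` are functions on `H × H` for the finite group `H = A ^ (2 n)`: for almost every
`t`, the digits of `x ⊕ t` are the sums of the digits of `x` and `t`, and `A_k` becomes the average
over the subgroup of the blocks whose digits in positions `≥ -k` vanish. General functions follow by
martingale approximation on grids and Fatou's lemma.

On `H`, put `z = x + y + t`, so that the average over `K` is a convolution of `f y z * g x z`. For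
subgroups `K ≤ L` and averages `T_K`, `T_L`, the squared `ℓ²` distance of `T_K` and `T_L` is
`‖T_K‖² - ‖T_L‖² - 2 Re ⟨T_K - T_L, T_L⟩`. The first difference telescopes along a chain of
subgroups. Since the uniform densities of `K` and `L` and their difference are convolution
idempotents, Cauchy–Schwarz bounds the cross term by box forms of `f` and of `g` whose kernels are
the uniform density of `L` and that difference. Positivity of the box form with kernels
(difference, `K`) turns this bound into the increment of the box energy, which telescopes as well.
This is the case `p = 2`, with `L⁴` norms on the right.

Larger `p` follow by Stein interpolation with the trivial `L^∞` bound.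
-/

noncomputable section

namespace FiniteGroupAverages

open Finset ComplexConjugate

section FiniteSums

lemma sum_sum_sum_sum_comm {α β γ δ M : Type*} [Fintype α] [Fintype β] [Fintype γ] [Fintype δ]
    [AddCommMonoid M] (T : α → β → γ → δ → M) :
    ∑ a, ∑ b, ∑ c, ∑ d, T a b c d = ∑ c, ∑ d, ∑ a, ∑ b, T a b c d := by
  simpa only [Fintype.sum_prod_type] using
    Finset.sum_comm (s := univ) (t := univ) (f := fun (p : α × β) (q : γ × δ) => T p.1 p.2 q.1 q.2)

lemma sum_succ_sub_castSucc {M : Type*} [AddCommGroup M] {m : ℕ} (T : Fin (m + 1) → M) :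
    ∑ j : Fin m, (T j.succ - T j.castSucc) = T (Fin.last m) - T 0 := by
  rw [Finset.sum_sub_distrib, sub_eq_sub_iff_add_eq_add, add_comm, ← Fin.sum_univ_succ,
    Fin.sum_univ_castSucc, add_comm]

lemma norm_sum_mul_sq_le {ι : Type*} (s : Finset ι) {w : ι → ℝ} (hw : ∀ i ∈ s, 0 ≤ w i)
    (hw₁ : ∑ i ∈ s, w i = 1) (u : ι → ℂ) :
    ‖∑ i ∈ s, (w i : ℂ) * u i‖ ^ 2 ≤ ∑ i ∈ s, w i * ‖u i‖ ^ 2 := by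
  have htriangle : ‖∑ i ∈ s, (w i : ℂ) * u i‖ ≤ ∑ i ∈ s, w i * ‖u i‖ := by
    refine (norm_sum_le _ _).trans_eq (Finset.sum_congr rfl fun i hi => ?_)
    rw [norm_mul, Complex.norm_real, Real.norm_of_nonneg (hw i hi)]
  calc ‖∑ i ∈ s, (w i : ℂ) * u i‖ ^ 2 ≤ (∑ i ∈ s, w i * ‖u i‖) ^ 2 := by gcongr
    _ ≤ ∑ i ∈ s, w i * ‖u i‖ ^ 2 :=
      (convexOn_pow 2).map_sum_le hw hw₁ fun i _ => Set.mem_Ici.2 (norm_nonneg _)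

lemma sq_mul_sq_le_half_add (a b : ℝ) : (a * b) ^ 2 ≤ (a ^ 4 + b ^ 4) / 2 := by
  nlinarith [sq_nonneg (a ^ 2 - b ^ 2)]

end FiniteSums

variable {H : Type*} [AddCommGroup H]

section UniformDensity

open Classical in
/-- The density, with respect to counting measure, of the uniform probability measure on a
finite subgroup `K`. -/
def uniformDensity (K : AddSubgroup H) (a : H) : ℝ :=
  if a ∈ K then (Nat.card K : ℝ)⁻¹ else 0

lemma uniformDensity_nonneg (K : AddSubgroup H) (a : H) : 0 ≤ uniformDensity K a := by
  unfold uniformDensity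
  split_ifs <;> positivity

lemma uniformDensity_neg (K : AddSubgroup H) (a : H) :
    uniformDensity K (-a) = uniformDensity K a := by
  unfold uniformDensity
  split_ifs <;> simp_all

lemma uniformDensity_mul_of_le {K L : AddSubgroup H} (h : K ≤ L) (a b : H) :
    uniformDensity K a * uniformDensity L b
      = uniformDensity K a * uniformDensity L (b - a) := by
  by_cases ha : a ∈ K
  · have : b - a ∈ L ↔ b ∈ L := by
      rw [sub_eq_add_neg, L.add_mem_cancel_right (L.neg_mem (h ha))]
    unfold uniformDensity
    split_ifs <;> simp_all
  · simp [uniformDensity, ha]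

variable [Fintype H]

lemma sum_uniformDensity (K : AddSubgroup H) : ∑ a, uniformDensity K a = 1 := by
  classical
  have hcard : (Nat.card K : ℝ) ≠ 0 := Nat.cast_ne_zero.2 Nat.card_pos.ne'
  simp only [uniformDensity]
  rw [← Finset.sum_filter, Finset.sum_const, nsmul_eq_mul, ← Fintype.card_subtype,
    ← Nat.card_eq_fintype_card]
  exact mul_inv_cancel₀ hcard

lemma sum_uniformDensity_sub_right (K : AddSubgroup H) (b : H) :
    ∑ a, uniformDensity K (a - b) = 1 :=
  (Equiv.sum_comp (Equiv.subRight b) (uniformDensity K)).trans (sum_uniformDensity K)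

lemma sum_uniformDensity_sub_left (K : AddSubgroup H) (b : H) :
    ∑ a, uniformDensity K (b - a) = 1 :=
  (Equiv.sum_comp (Equiv.subLeft b) (uniformDensity K)).trans (sum_uniformDensity K)

lemma sum_sum_uniformDensity_mul_left (K : AddSubgroup H) (g : H → ℝ) :
    ∑ a, ∑ b, uniformDensity K (a - b) * g a = ∑ a, g a := by
  simp_rw [← Finset.sum_mul, sum_uniformDensity_sub_left, one_mul]

lemma sum_sum_uniformDensity_mul_right (K : AddSubgroup H) (g : H → ℝ) :
    ∑ a, ∑ b, uniformDensity K (a - b) * g b = ∑ b, g b := by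
  rw [Finset.sum_comm]
  simp_rw [← Finset.sum_mul, sum_uniformDensity_sub_right, one_mul]

lemma uniformDensity_conv_of_le {K L : AddSubgroup H} (h : K ≤ L) (a b : H) :
    ∑ s, uniformDensity K (a - s) * uniformDensity L (s - b) = uniformDensity L (a - b) := by
  have hshift (s : H) : uniformDensity K (a - s) * uniformDensity L (s - b)
      = uniformDensity K (a - s) * uniformDensity L (a - b) := by
    rw [uniformDensity_mul_of_le h (a - s) (a - b), show a - b - (a - s) = s - b by abel]
  simp_rw [hshift, ← Finset.sum_mul, sum_uniformDensity_sub_left, one_mul]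

lemma uniformDensity_conv_of_ge {K L : AddSubgroup H} (h : K ≤ L) (a b : H) :
    ∑ s, uniformDensity L (a - s) * uniformDensity K (s - b) = uniformDensity L (a - b) := by
  rw [← neg_sub, uniformDensity_neg, ← uniformDensity_conv_of_le h b a]
  refine Finset.sum_congr rfl fun s _ => ?_
  rw [← neg_sub, uniformDensity_neg, ← neg_sub b s, uniformDensity_neg, mul_comm]

end UniformDensity

variable [Fintype H]

section EvenIdempotent

/-- Real even functions that are idempotent under convolution: the convolution kernels of
orthogonal projections. Idempotency is stated for the kernel `(a, b) ↦ ψ (a - b)`. -/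
structure EvenIdempotent (ψ : H → ℝ) : Prop where
  even : ∀ a, ψ (-a) = ψ a
  conv : ∀ a b, ∑ s, ψ (a - s) * ψ (s - b) = ψ (a - b)

lemma evenIdempotent_uniformDensity (K : AddSubgroup H) : EvenIdempotent (uniformDensity K) :=
  ⟨uniformDensity_neg K, uniformDensity_conv_of_le le_rfl⟩

lemma evenIdempotent_sub {K L : AddSubgroup H} (h : K ≤ L) :
    EvenIdempotent (uniformDensity K - uniformDensity L) := by
  refine ⟨fun a => by simp only [Pi.sub_apply, uniformDensity_neg], fun a b => ?_⟩
  simp only [Pi.sub_apply, sub_mul, mul_sub, Finset.sum_sub_distrib, uniformDensity_conv_of_ge h,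
    uniformDensity_conv_of_le h, uniformDensity_conv_of_le le_rfl]
  ring

/-- The squared `ℓ²` norm of the convolution `ψ * u`. -/
def convEnergy (ψ : H → ℝ) (u : H → ℂ) : ℝ := ∑ s, ‖∑ y, (ψ (s - y) : ℂ) * u y‖ ^ 2

lemma convEnergy_nonneg (ψ : H → ℝ) (u : H → ℂ) : 0 ≤ convEnergy ψ u :=
  Finset.sum_nonneg fun _ _ => sq_nonneg _

lemma convEnergy_uniformDensity_le (K : AddSubgroup H) (u : H → ℂ) :
    convEnergy (uniformDensity K) u ≤ ∑ y, ‖u y‖ ^ 2 :=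
  calc convEnergy (uniformDensity K) u
      ≤ ∑ s, ∑ y, uniformDensity K (s - y) * ‖u y‖ ^ 2 := Finset.sum_le_sum fun s _ =>
        norm_sum_mul_sq_le _ (fun _ _ => uniformDensity_nonneg K _)
          (sum_uniformDensity_sub_left K s) u
    _ = ∑ y, ‖u y‖ ^ 2 := sum_sum_uniformDensity_mul_right K _

variable {ψ : H → ℝ}

lemma EvenIdempotent.convEnergy_eq (hψ : EvenIdempotent ψ) (u : H → ℂ) :
    (convEnergy ψ u : ℂ) = ∑ y, ∑ y', (ψ (y - y') : ℂ) * (u y * conj (u y')) := by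
  have hsq (s : H) : ((‖∑ y, (ψ (s - y) : ℂ) * u y‖ ^ 2 : ℝ) : ℂ)
      = ∑ y, ∑ y', ((ψ (y - s) * ψ (s - y') : ℝ) : ℂ) * (u y * conj (u y')) := by
    rw [Complex.ofReal_pow, ← Complex.mul_conj', map_sum, Finset.sum_mul_sum]
    refine Finset.sum_congr rfl fun y _ => Finset.sum_congr rfl fun y' _ => ?_
    rw [← hψ.even (s - y), neg_sub]
    simp only [map_mul, Complex.conj_ofReal, Complex.ofReal_mul]
    ring
  simp_rw [convEnergy, Complex.ofReal_sum, hsq]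
  rw [Finset.sum_comm]
  refine Finset.sum_congr rfl fun y _ => ?_
  rw [Finset.sum_comm]
  refine Finset.sum_congr rfl fun y' _ => ?_
  rw [← Finset.sum_mul, ← Complex.ofReal_sum, hψ.conv]

lemma EvenIdempotent.sum_mul_eq_sum_conv_mul_conv (hψ : EvenIdempotent ψ) (u v : H → ℂ) (z : H) :
    ∑ x, ∑ y, (ψ (z - x - y) : ℂ) * (u y * v x)
      = ∑ s, (∑ y, (ψ (s - y) : ℂ) * u y) * ∑ x, (ψ (z - s - x) : ℂ) * v x := by
  simp_rw [Finset.sum_mul_sum]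
  conv_rhs => rw [Finset.sum_comm]; enter [2, y]; rw [Finset.sum_comm]
  rw [Finset.sum_comm]
  refine Finset.sum_congr rfl fun y _ => Finset.sum_congr rfl fun x _ => ?_
  rw [← hψ.conv, Complex.ofReal_sum, Finset.sum_mul]
  refine Finset.sum_congr rfl fun s _ => ?_
  rw [Complex.ofReal_mul, show z - x - s = z - s - x by abel]
  ring

lemma EvenIdempotent.norm_sum_mul_le (hψ : EvenIdempotent ψ) (u v : H → ℂ) (z : H) :
    ‖∑ x, ∑ y, (ψ (z - x - y) : ℂ) * (u y * v x)‖ ≤ (convEnergy ψ u + convEnergy ψ v) / 2 := by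
  have hv : convEnergy ψ v = ∑ s, ‖∑ x, (ψ (z - s - x) : ℂ) * v x‖ ^ 2 :=
    (Equiv.sum_comp (Equiv.subLeft z) (fun s => ‖∑ x, (ψ (s - x) : ℂ) * v x‖ ^ 2)).symm
  rw [hψ.sum_mul_eq_sum_conv_mul_conv, hv, convEnergy, ← Finset.sum_add_distrib, Finset.sum_div]
  refine (norm_sum_le _ _).trans (Finset.sum_le_sum fun s _ => ?_)
  rw [norm_mul]
  linarith [two_mul_le_add_sq ‖∑ y, (ψ (s - y) : ℂ) * u y‖ ‖∑ x, (ψ (z - s - x) : ℂ) * v x‖]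

end EvenIdempotent

section BoxForm

/-- The box form of `f` with kernels `a`, `b`: the sum of the products of `f`, with alternating
conjugations, over the corners of all boxes `{y, y'} × {z, z'}`, weighted by
`a (z - z') * b (y - y')`. For even kernels the sum is real, so only its real part is kept. -/
def boxForm (f : H → H → ℂ) (a b : H → ℝ) : ℝ :=
  (∑ z, ∑ z', ∑ y, ∑ y', (a (z - z') : ℂ) * ((b (y - y') : ℂ) *
    (f y z * conj (f y z') * conj (f y' z * conj (f y' z'))))).re

variable {a b : H → ℝ}

lemma EvenIdempotent.boxForm_right (hb : EvenIdempotent b) (f : H → H → ℂ) (a : H → ℝ) :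
    boxForm f a b = ∑ z, ∑ z', a (z - z') * convEnergy b (fun y => f y z * conj (f y z')) := by
  rw [boxForm, ← Complex.ofReal_re (∑ z, ∑ z', _)]
  congr 1
  simp only [Complex.ofReal_sum, Complex.ofReal_mul, hb.convEnergy_eq, Finset.mul_sum]

lemma EvenIdempotent.boxForm_left (ha : EvenIdempotent a) (f : H → H → ℂ) (b : H → ℝ) :
    boxForm f a b = ∑ y, ∑ y', b (y - y') * convEnergy a (fun z => f y z * conj (f y' z)) := by
  rw [boxForm, ← Complex.ofReal_re (∑ y, ∑ y', _)]
  congr 1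
  simp only [Complex.ofReal_sum, Complex.ofReal_mul, ha.convEnergy_eq, Finset.mul_sum]
  rw [sum_sum_sum_sum_comm]
  refine Finset.sum_congr rfl fun y _ => Finset.sum_congr rfl fun y' _ =>
    Finset.sum_congr rfl fun z _ => Finset.sum_congr rfl fun z' _ => ?_
  simp only [map_mul, Complex.conj_conj]
  ring

lemma EvenIdempotent.boxForm_left_nonneg (ha : EvenIdempotent a) (hb : ∀ h, 0 ≤ b h)
    (f : H → H → ℂ) : 0 ≤ boxForm f a b := by
  rw [ha.boxForm_left]
  exact Finset.sum_nonneg fun y _ => Finset.sum_nonneg fun y' _ =>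
    mul_nonneg (hb _) (convEnergy_nonneg _ _)

lemma boxForm_sub_left (f : H → H → ℂ) (a a' b : H → ℝ) :
    boxForm f (a - a') b = boxForm f a b - boxForm f a' b := by
  simp only [boxForm, ← Complex.sub_re, ← Finset.sum_sub_distrib, Pi.sub_apply,
    Complex.ofReal_sub, sub_mul]

lemma boxForm_sub_right (f : H → H → ℂ) (a b b' : H → ℝ) :
    boxForm f a (b - b') = boxForm f a b - boxForm f a b' := by
  simp only [boxForm, ← Complex.sub_re, ← Finset.sum_sub_distrib, Pi.sub_apply,
    Complex.ofReal_sub, sub_mul, mul_sub]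

/-- The box energy of `f` at the scale of the subgroup `K`, which increases as `K` shrinks. -/
def boxEnergy (K : AddSubgroup H) (f : H → H → ℂ) : ℝ :=
  boxForm f (uniformDensity K) (uniformDensity K)

lemma boxEnergy_nonneg (K : AddSubgroup H) (f : H → H → ℂ) : 0 ≤ boxEnergy K f :=
  (evenIdempotent_uniformDensity K).boxForm_left_nonneg (uniformDensity_nonneg K) f

lemma boxForm_sub_le {K L : AddSubgroup H} (h : K ≤ L) (f : H → H → ℂ) :
    boxForm f (uniformDensity L) (uniformDensity K - uniformDensity L)
      ≤ boxEnergy K f - boxEnergy L f := by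
  have hpos := (evenIdempotent_sub h).boxForm_left_nonneg (uniformDensity_nonneg K) f
  rw [boxForm_sub_left] at hpos
  rw [boxForm_sub_right, boxEnergy, boxEnergy]
  linarith

lemma boxEnergy_le (K : AddSubgroup H) (f : H → H → ℂ) :
    boxEnergy K f ≤ ∑ y, ∑ z, ‖f y z‖ ^ 4 := by
  have henergy (z z' : H) : convEnergy (uniformDensity K) (fun y => f y z * conj (f y z'))
      ≤ ∑ y, (‖f y z‖ ^ 4 + ‖f y z'‖ ^ 4) / 2 := by
    refine (convEnergy_uniformDensity_le K _).trans (Finset.sum_le_sum fun y _ => ?_)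
    rw [norm_mul, RCLike.norm_conj]
    exact sq_mul_sq_le_half_add _ _
  calc boxEnergy K f
      = ∑ z, ∑ z', uniformDensity K (z - z')
          * convEnergy (uniformDensity K) (fun y => f y z * conj (f y z')) :=
        (evenIdempotent_uniformDensity K).boxForm_right f _
    _ ≤ ∑ z, ∑ z', uniformDensity K (z - z') * ∑ y, (‖f y z‖ ^ 4 + ‖f y z'‖ ^ 4) / 2 :=
        Finset.sum_le_sum fun z _ => Finset.sum_le_sum fun z' _ =>
          mul_le_mul_of_nonneg_left (henergy z z') (uniformDensity_nonneg K _)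
    _ = (∑ z, ∑ z', uniformDensity K (z - z') * ∑ y, ‖f y z‖ ^ 4
          + ∑ z, ∑ z', uniformDensity K (z - z') * ∑ y, ‖f y z'‖ ^ 4) / 2 := by
        simp only [← Finset.sum_div, mul_div_assoc', Finset.sum_add_distrib, mul_add]
    _ = ∑ z, ∑ y, ‖f y z‖ ^ 4 := by
        rw [sum_sum_uniformDensity_mul_left K fun z => ∑ y, ‖f y z‖ ^ 4,
          sum_sum_uniformDensity_mul_right K fun z => ∑ y, ‖f y z‖ ^ 4, add_self_div_two]
    _ = ∑ y, ∑ z, ‖f y z‖ ^ 4 := Finset.sum_comm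

end BoxForm

section TriAverage

/-- The average of `f y z * g x z` over `z ∈ x + y + K`. The bilinear averages take this
triangular form after the change of variables `z = x + y + t`. -/
def triAverage (K : AddSubgroup H) (f g : H → H → ℂ) (x y : H) : ℂ :=
  ∑ z, (uniformDensity K (z - x - y) : ℂ) * (f y z * g x z)

/-- The squared `ℓ²` norm of `triAverage K f g`. -/
def triEnergy (K : AddSubgroup H) (f g : H → H → ℂ) : ℝ :=
  ∑ x, ∑ y, ‖triAverage K f g x y‖ ^ 2

lemma triEnergy_nonneg (K : AddSubgroup H) (f g : H → H → ℂ) : 0 ≤ triEnergy K f g :=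
  Finset.sum_nonneg fun _ _ => Finset.sum_nonneg fun _ _ => sq_nonneg _

lemma triEnergy_le (K : AddSubgroup H) (f g : H → H → ℂ) :
    triEnergy K f g ≤ (∑ y, ∑ z, ‖f y z‖ ^ 4 + ∑ x, ∑ z, ‖g x z‖ ^ 4) / 2 := by
  have hpoint (x y : H) : ‖triAverage K f g x y‖ ^ 2
      ≤ ∑ z, uniformDensity K (z - x - y) * ((‖f y z‖ ^ 4 + ‖g x z‖ ^ 4) / 2) := by
    have hsum : ∑ z, uniformDensity K (z - x - y) = 1 := by
      simp_rw [sub_sub, sum_uniformDensity_sub_right]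
    refine (norm_sum_mul_sq_le _ (fun z _ => uniformDensity_nonneg K _) hsum _).trans
      (Finset.sum_le_sum fun z _ => mul_le_mul_of_nonneg_left ?_ (uniformDensity_nonneg K _))
    rw [norm_mul]
    exact sq_mul_sq_le_half_add _ _
  have hf : ∑ x, ∑ y, ∑ z, uniformDensity K (z - x - y) * ‖f y z‖ ^ 4 = ∑ y, ∑ z, ‖f y z‖ ^ 4 := by
    rw [Finset.sum_comm]
    refine Finset.sum_congr rfl fun y _ => ?_
    rw [Finset.sum_comm]
    simp_rw [sub_right_comm _ _ y, ← Finset.sum_mul, sum_uniformDensity_sub_left, one_mul]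
  have hg : ∑ x, ∑ y, ∑ z, uniformDensity K (z - x - y) * ‖g x z‖ ^ 4 = ∑ x, ∑ z, ‖g x z‖ ^ 4 := by
    refine Finset.sum_congr rfl fun x _ => ?_
    rw [Finset.sum_comm]
    simp_rw [← Finset.sum_mul, sum_uniformDensity_sub_left, one_mul]
  refine (Finset.sum_le_sum fun x _ => Finset.sum_le_sum fun y _ => hpoint x y).trans_eq ?_
  simp only [mul_div_assoc', ← Finset.sum_div, mul_add, Finset.sum_add_distrib, hf, hg]

variable {K L : AddSubgroup H}

lemma sum_triAverage_mul_conj (h : K ≤ L) (f g : H → H → ℂ) :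
    ∑ x, ∑ y, triAverage K f g x y * conj (triAverage L f g x y)
      = ∑ z, ∑ z', (uniformDensity L (z - z') : ℂ) * ∑ x, ∑ y,
        (uniformDensity K (z - x - y) : ℂ) *
          ((f y z * conj (f y z')) * (g x z * conj (g x z'))) := by
  simp only [triAverage, map_sum, Finset.sum_mul_sum]
  simp only [Finset.mul_sum]
  rw [sum_sum_sum_sum_comm]
  refine Finset.sum_congr rfl fun z _ => Finset.sum_congr rfl fun z' _ =>
    Finset.sum_congr rfl fun x _ => Finset.sum_congr rfl fun y _ => ?_
  have hshift : (uniformDensity K (z - x - y) : ℂ) * uniformDensity L (z' - x - y)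
      = uniformDensity K (z - x - y) * uniformDensity L (z - z') := by
    have := uniformDensity_mul_of_le h (z - x - y) (z' - x - y)
    rw [show z' - x - y - (z - x - y) = -(z - z') by abel, uniformDensity_neg] at this
    exact_mod_cast this
  simp only [map_mul, Complex.conj_ofReal]
  linear_combination (f y z * g x z * (conj (f y z') * conj (g x z'))) * hshift

lemma norm_sum_triAverage_sub_mul_conj_le (h : K ≤ L) (f g : H → H → ℂ) :
    ‖∑ x, ∑ y, (triAverage K f g x y - triAverage L f g x y) * conj (triAverage L f g x y)‖
      ≤ (boxForm f (uniformDensity L) (uniformDensity K - uniformDensity L)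
        + boxForm g (uniformDensity L) (uniformDensity K - uniformDensity L)) / 2 := by
  have hψ := evenIdempotent_sub h
  set ψ := uniformDensity K - uniformDensity L with hψ_def
  have hcross : ∑ x, ∑ y, (triAverage K f g x y - triAverage L f g x y)
        * conj (triAverage L f g x y)
      = ∑ z, ∑ z', (uniformDensity L (z - z') : ℂ) * ∑ x, ∑ y,
        (ψ (z - x - y) : ℂ) * ((f y z * conj (f y z')) * (g x z * conj (g x z'))) := by
    simp only [sub_mul, Finset.sum_sub_distrib, sum_triAverage_mul_conj h,
      sum_triAverage_mul_conj le_rfl, hψ_def, Pi.sub_apply, Complex.ofReal_sub, mul_sub]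
  rw [hcross, hψ.boxForm_right, hψ.boxForm_right]
  simp only [← Finset.sum_add_distrib, Finset.sum_div]
  refine (norm_sum_le _ _).trans (Finset.sum_le_sum fun z _ => (norm_sum_le _ _).trans
    (Finset.sum_le_sum fun z' _ => ?_))
  rw [norm_mul, Complex.norm_real, Real.norm_of_nonneg (uniformDensity_nonneg _ _), ← mul_add,
    mul_div_assoc]
  exact mul_le_mul_of_nonneg_left (hψ.norm_sum_mul_le _ _ z) (uniformDensity_nonneg _ _)

lemma sum_norm_triAverage_sub_sq_le (h : K ≤ L) (f g : H → H → ℂ) :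
    ∑ x, ∑ y, ‖triAverage K f g x y - triAverage L f g x y‖ ^ 2
      ≤ (triEnergy K f g - triEnergy L f g) + (boxEnergy K f - boxEnergy L f)
        + (boxEnergy K g - boxEnergy L g) := by
  have hpolar (u v : ℂ) : ‖u - v‖ ^ 2 = ‖u‖ ^ 2 - ‖v‖ ^ 2 - 2 * ((u - v) * conj v).re := by
    have := Complex.normSq_sub u v
    simp only [Complex.normSq_eq_norm_sq] at this
    rw [this, sub_mul, Complex.sub_re, Complex.mul_conj', ← Complex.ofReal_pow, Complex.ofReal_re]
    ring
  have hsplit : ∑ x, ∑ y, ‖triAverage K f g x y - triAverage L f g x y‖ ^ 2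
      = triEnergy K f g - triEnergy L f g - 2 * (∑ x, ∑ y,
        (triAverage K f g x y - triAverage L f g x y) * conj (triAverage L f g x y)).re := by
    simp only [triEnergy, hpolar, Finset.sum_sub_distrib, Complex.re_sum, Finset.mul_sum]
  have hcross := neg_le_of_abs_le ((Complex.abs_re_le_norm _).trans
    (norm_sum_triAverage_sub_mul_conj_le h f g))
  linarith [boxForm_sub_le h f, boxForm_sub_le h g]

theorem sum_triAverage_variation_sq_le {m : ℕ} {K : Fin (m + 1) → AddSubgroup H}
    (hK : Antitone K) (f g : H → H → ℂ) :
    ∑ j : Fin m, ∑ x, ∑ y, ‖triAverage (K j.succ) f g x y - triAverage (K j.castSucc) f g x y‖ ^ 2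
      ≤ 3 / 2 * (∑ y, ∑ z, ‖f y z‖ ^ 4 + ∑ x, ∑ z, ‖g x z‖ ^ 4) := by
  refine (Finset.sum_le_sum fun j _ => sum_norm_triAverage_sub_sq_le
    (hK (Fin.castSucc_lt_succ (i := j)).le) f g).trans ?_
  rw [Finset.sum_add_distrib, Finset.sum_add_distrib,
    sum_succ_sub_castSucc (fun j => triEnergy (K j) f g),
    sum_succ_sub_castSucc (fun j => boxEnergy (K j) f),
    sum_succ_sub_castSucc (fun j => boxEnergy (K j) g)]
  linarith [triEnergy_le (K (Fin.last m)) f g, triEnergy_nonneg (K 0) f g,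
    boxEnergy_le (K (Fin.last m)) f, boxEnergy_nonneg (K 0) f,
    boxEnergy_le (K (Fin.last m)) g, boxEnergy_nonneg (K 0) g]

end TriAverage

section SubgroupAverage

/-- The bilinear average of `F` and `G` over the translations by a subgroup `K`: the finite
model of `CantorGroup.bilinearAverage`. -/
def subgroupAverage (K : AddSubgroup H) (F G : H × H → ℂ) (z : H × H) : ℂ :=
  ∑ t, (uniformDensity K t : ℂ) * (F (z.1 + t, z.2) * G (z.1, z.2 + t))

lemma subgroupAverage_eq_triAverage (K : AddSubgroup H) (F G : H × H → ℂ) (x y : H) :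
    subgroupAverage K F G (x, y)
      = triAverage K (fun y z => F (z - y, y)) (fun x z => G (x, z - x)) x y := by
  rw [subgroupAverage, triAverage, ← Equiv.sum_comp (Equiv.subRight (x + y))]
  refine Finset.sum_congr rfl fun z _ => ?_
  simp only [Equiv.subRight_apply, sub_sub]
  rw [show x + (z - (x + y)) = z - y by abel, show y + (z - (x + y)) = z - x by abel]

lemma norm_subgroupAverage_le_one (K : AddSubgroup H) {F G : H × H → ℂ} (hF : ∀ z, ‖F z‖ ≤ 1)
    (hG : ∀ z, ‖G z‖ ≤ 1) (z : H × H) : ‖subgroupAverage K F G z‖ ≤ 1 := by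
  rw [← sum_uniformDensity K]
  refine (norm_sum_le _ _).trans (Finset.sum_le_sum fun t _ => ?_)
  rw [norm_mul, norm_mul, Complex.norm_real, Real.norm_of_nonneg (uniformDensity_nonneg _ _)]
  exact mul_le_of_le_one_right (uniformDensity_nonneg _ _)
    (mul_le_one₀ (hF _) (norm_nonneg _) (hG _))

lemma subgroupAverage_smul_smul (K : AddSubgroup H) (a b : ℂ) (F G : H × H → ℂ) (z : H × H) :
    subgroupAverage K (a • F) (b • G) z = a * b * subgroupAverage K F G z := by
  simp only [subgroupAverage, Finset.mul_sum, Pi.smul_apply, smul_eq_mul]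
  exact Finset.sum_congr rfl fun t _ => by ring

theorem sum_subgroupAverage_variation_sq_le {m : ℕ} {K : Fin (m + 1) → AddSubgroup H}
    (hK : Antitone K) (F G : H × H → ℂ) :
    ∑ j : Fin m, ∑ z, ‖subgroupAverage (K j.succ) F G z - subgroupAverage (K j.castSucc) F G z‖ ^ 2
      ≤ 3 / 2 * (∑ z, ‖F z‖ ^ 4 + ∑ z, ‖G z‖ ^ 4) := by
  have hF : ∑ y, ∑ z, ‖F (z - y, y)‖ ^ 4 = ∑ z, ‖F z‖ ^ 4 := by
    rw [Fintype.sum_prod_type_right]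
    exact Finset.sum_congr rfl fun y _ =>
      Equiv.sum_comp (Equiv.subRight y) (fun z => ‖F (z, y)‖ ^ 4)
  have hG : ∑ x, ∑ z, ‖G (x, z - x)‖ ^ 4 = ∑ z, ‖G z‖ ^ 4 := by
    rw [Fintype.sum_prod_type]
    exact Finset.sum_congr rfl fun x _ =>
      Equiv.sum_comp (Equiv.subRight x) (fun z => ‖G (x, z)‖ ^ 4)
  have h := sum_triAverage_variation_sq_le hK (fun y z => F (z - y, y)) (fun x z => G (x, z - x))
  rw [hF, hG] at h
  refine (Finset.sum_congr rfl fun j _ => ?_).trans_le h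
  rw [Fintype.sum_prod_type]
  simp only [subgroupAverage_eq_triAverage]

end SubgroupAverage

end FiniteGroupAverages

namespace ComplexInterpolation

open Finset ComplexConjugate Complex HadamardThreeLines

section PhasePow

/-- The complex power `‖w‖ ^ z` times the phase of `w`, which is entire in `z`; zero if `w = 0`. -/
def phasePow (w z : ℂ) : ℂ := w / ‖w‖ * exp (z * Real.log ‖w‖)

lemma differentiable_phasePow (w : ℂ) : Differentiable ℂ (phasePow w) := by
  unfold phasePow
  fun_prop

lemma phasePow_zero_left (z : ℂ) : phasePow 0 z = 0 := by simp [phasePow]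

lemma norm_phasePow {w : ℂ} (hw : w ≠ 0) (z : ℂ) : ‖phasePow w z‖ = ‖w‖ ^ z.re := by
  have h : 0 < ‖w‖ := norm_pos_iff.2 hw
  rw [phasePow, norm_mul, norm_div, norm_real, norm_norm, div_self h.ne', one_mul, norm_exp,
    Real.rpow_def_of_pos h, re_mul_ofReal, mul_comm]

lemma norm_phasePow_le (w z : ℂ) : ‖phasePow w z‖ ≤ ‖w‖ ^ z.re := by
  rcases eq_or_ne w 0 with rfl | hw
  · rw [phasePow_zero_left, norm_zero]
    positivity
  · exact (norm_phasePow hw z).le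

lemma phasePow_one (w : ℂ) : phasePow w 1 = w := by
  rcases eq_or_ne w 0 with rfl | hw
  · exact phasePow_zero_left 1
  · have h : 0 < ‖w‖ := norm_pos_iff.2 hw
    rw [phasePow, one_mul, ← ofReal_exp, Real.exp_log h,
      div_mul_cancel₀ _ (ofReal_ne_zero.2 h.ne')]

lemma mul_phasePow_conj (w : ℂ) {q : ℝ} (hq : q ≠ 0) :
    w * phasePow (conj w) ((q - 1 : ℝ) : ℂ) = ((‖w‖ ^ q : ℝ) : ℂ) := by
  rcases eq_or_ne w 0 with rfl | hw
  · rw [zero_mul, norm_zero, Real.zero_rpow hq, ofReal_zero]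
  · have h : 0 < ‖w‖ := norm_pos_iff.2 hw
    have h' : (‖w‖ : ℂ) ≠ 0 := ofReal_ne_zero.2 h.ne'
    rw [phasePow, RCLike.norm_conj, ← mul_assoc, mul_div_assoc', mul_conj', ← ofReal_mul,
      ← ofReal_exp, mul_comm (q - 1), ← Real.rpow_def_of_pos h, Real.rpow_sub_one h.ne']
    push_cast
    field_simp

/-- The analytic family through the dual vector `phasePow (conj w) (p - 1)` of `w`, attained at
`z = q / p`, whose modulus is `‖w‖ ^ p` on `re z = 0` and `‖w‖ ^ (p - p / q)` on `re z = 1`. -/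
def dualPow (p q : ℝ) (w z : ℂ) : ℂ := phasePow (conj w) (p - (p / q : ℝ) * z)

variable {p q : ℝ}

lemma differentiable_dualPow (p q : ℝ) (w : ℂ) : Differentiable ℂ (dualPow p q w) :=
  (differentiable_phasePow _).comp (by fun_prop)

lemma norm_dualPow_le (p q : ℝ) (w z : ℂ) : ‖dualPow p q w z‖ ≤ ‖w‖ ^ (p - p / q * z.re) := by
  refine (norm_phasePow_le _ _).trans_eq ?_
  rw [sub_re, re_ofReal_mul, ofReal_re, RCLike.norm_conj]

lemma norm_dualPow_le_of_mem_strip (hp : 0 ≤ p) (hq : 1 ≤ q) (w : ℂ) {z : ℂ}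
    (hz : z ∈ verticalClosedStrip 0 1) : ‖dualPow p q w z‖ ≤ (1 + ‖w‖) ^ p := by
  obtain ⟨hz₀, hz₁⟩ : 0 ≤ z.re ∧ z.re ≤ 1 := hz
  have hslope : p / q ≤ p := div_le_self hp hq
  have hslope₀ : 0 ≤ p / q := by positivity
  calc ‖dualPow p q w z‖ ≤ ‖w‖ ^ (p - p / q * z.re) := norm_dualPow_le p q w z
    _ ≤ (1 + ‖w‖) ^ (p - p / q * z.re) :=
      Real.rpow_le_rpow (norm_nonneg w) (by linarith) (by nlinarith)
    _ ≤ (1 + ‖w‖) ^ p :=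
      Real.rpow_le_rpow_of_exponent_le (by linarith [norm_nonneg w]) (by nlinarith)

lemma mul_dualPow (hp : p ≠ 0) (hq : q ≠ 0) (w : ℂ) :
    w * dualPow p q w ((q / p : ℝ) : ℂ) = ((‖w‖ ^ p : ℝ) : ℂ) := by
  rw [← mul_phasePow_conj w hp, dualPow, ← ofReal_mul, ← ofReal_sub,
    div_mul_div_cancel₀ hq, div_self hp]

end PhasePow

section ThreeLines

variable {κ : Type*} [Fintype κ]

lemma le_of_le_rpow_mul_rpow {S N C p q : ℝ} (hS : 0 ≤ S) (hN : 0 ≤ N) (hC : 0 ≤ C)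
    (hq : 1 < q) (hqp : q ≤ p)
    (h : S ≤ (N * S) ^ (1 - q / p) * (C ^ (1 / q) * S ^ (1 - 1 / q)) ^ (q / p)) :
    S ≤ N ^ (p - q) * C := by
  have hq₀ : 0 < q := by linarith
  have hp₀ : 0 < p := by linarith
  rcases hS.eq_or_lt with rfl | hSpos
  · positivity
  refine le_of_mul_le_mul_left ?_ (Real.rpow_pos_of_pos hSpos (p - 1))
  calc S ^ (p - 1) * S = S ^ p := by rw [← Real.rpow_add_one hSpos.ne', sub_add_cancel]
    _ ≤ ((N * S) ^ (1 - q / p) * (C ^ (1 / q) * S ^ (1 - 1 / q)) ^ (q / p)) ^ p := by gcongr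
    _ = (N * S) ^ (p - q) * (C ^ (1 / q) * S ^ (1 - 1 / q)) ^ q := by
      rw [Real.mul_rpow (by positivity) (by positivity), ← Real.rpow_mul (by positivity),
        ← Real.rpow_mul (by positivity), show (1 - q / p) * p = p - q by field_simp,
        show q / p * p = q by field_simp]
    _ = (N * S) ^ (p - q) * (C * S ^ (q - 1)) := by
      rw [Real.mul_rpow (x := C ^ _) (by positivity) (by positivity), ← Real.rpow_mul hC,
        ← Real.rpow_mul hS, one_div_mul_cancel hq₀.ne', Real.rpow_one,
        show (1 - 1 / q) * q = q - 1 by field_simp]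
    _ = S ^ (p - 1) * (N ^ (p - q) * C) := by
      rw [Real.mul_rpow hN hS, show p - 1 = (p - q) + (q - 1) by ring, Real.rpow_add hSpos]
      ring

lemma sum_mul_norm_rpow_le {T D : κ → ℂ} {p q C : ℝ} (hq : 1 < q)
    (hT : ∑ k, ‖T k‖ ^ q ≤ C) :
    ∑ k, ‖T k‖ * ‖D k‖ ^ (p - p / q) ≤ C ^ (1 / q) * (∑ k, ‖D k‖ ^ p) ^ (1 - 1 / q) := by
  have hpq := Real.HolderConjugate.conjExponent hq
  have hexp : (p - p / q) * q.conjExponent = p := by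
    have : q - 1 ≠ 0 := by linarith
    rw [Real.conjExponent]
    field_simp
  have hinv : 1 / q.conjExponent = 1 - 1 / q := by
    have : q - 1 ≠ 0 := by linarith
    rw [Real.conjExponent]
    field_simp
  refine (Real.inner_le_Lp_mul_Lq_of_nonneg univ hpq (fun k _ => norm_nonneg (T k))
    (fun k _ => by positivity)).trans ?_
  simp_rw [← Real.rpow_mul (norm_nonneg _), hexp, hinv]
  gcongr

lemma diffContOnCl_sum {ι : Type*} {U : Set ℂ} {f : ι → ℂ → ℂ} (s : Finset ι)
    (hf : ∀ i ∈ s, DiffContOnCl ℂ (f i) U) : DiffContOnCl ℂ (fun z => ∑ i ∈ s, f i z) U :=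
  ⟨DifferentiableOn.fun_sum fun i hi => (hf i hi).1,
    continuousOn_finsetSum s fun i hi => (hf i hi).2⟩

/-- Stein interpolation between `ℓ^∞` and `ℓ^q`: Hadamard's three lines theorem for the pairing of
`T` with the dual family of its value at `q / p`. -/
theorem sum_norm_rpow_le_of_diffContOnCl {T : κ → ℂ → ℂ}
    (hT : ∀ k, DiffContOnCl ℂ (T k) (verticalStrip 0 1)) {N C p q : ℝ} (hq : 1 < q) (hqp : q ≤ p)
    (hN₀ : 0 ≤ N) (hN : ∀ k, ∀ z ∈ verticalClosedStrip 0 1, ‖T k z‖ ≤ N)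
    (hC : ∀ z : ℂ, z.re = 1 → ∑ k, ‖T k z‖ ^ q ≤ C) :
    ∑ k, ‖T k ((q / p : ℝ) : ℂ)‖ ^ p ≤ N ^ (p - q) * C := by
  have hq₀ : 0 < q := by linarith
  have hp₀ : 0 < p := by linarith
  have hC₀ : 0 ≤ C := (Finset.sum_nonneg fun k _ => by positivity).trans (hC 1 one_re)
  set D : κ → ℂ := fun k => T k ((q / p : ℝ) : ℂ)
  set S : ℝ := ∑ k, ‖D k‖ ^ p with hS
  have hS₀ : 0 ≤ S := Finset.sum_nonneg fun k _ => by positivity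
  let Φ : ℂ → ℂ := fun z => ∑ k, T k z * dualPow p q (D k) z
  have hΦ : DiffContOnCl ℂ Φ (verticalStrip 0 1) :=
    diffContOnCl_sum _ fun k _ => (hT k).smul (differentiable_dualPow p q (D k)).diffContOnCl
  have hbdd : BddAbove ((norm ∘ Φ) '' verticalClosedStrip 0 1) := by
    refine ⟨∑ k, N * (1 + ‖D k‖) ^ p, ?_⟩
    rintro _ ⟨z, hz, rfl⟩
    exact norm_sum_le_of_le _ fun k _ => norm_mul_le_of_le (hN k z hz)
      (norm_dualPow_le_of_mem_strip hp₀.le hq.le (D k) hz)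
  have hleft : ∀ z ∈ re ⁻¹' {(0 : ℝ)}, ‖Φ z‖ ≤ N * S := fun z (hz : z.re = 0) => by
    rw [hS, Finset.mul_sum]
    refine norm_sum_le_of_le _ fun k _ => norm_mul_le_of_le (hN k z ?_)
      ((norm_dualPow_le p q (D k) z).trans_eq (by rw [hz, mul_zero, sub_zero]))
    exact ⟨hz.ge, hz.le.trans zero_le_one⟩
  have hright : ∀ z ∈ re ⁻¹' {(1 : ℝ)}, ‖Φ z‖ ≤ C ^ (1 / q) * S ^ (1 - 1 / q) :=
    fun z (hz : z.re = 1) => by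
      refine (norm_sum_le_of_le _ fun k _ => norm_mul_le_of_le le_rfl
        (norm_dualPow_le p q (D k) z)).trans ?_
      rw [hz, mul_one]
      exact sum_mul_norm_rpow_le hq (hC z hz)
  have hθ : ((q / p : ℝ) : ℂ) ∈ verticalClosedStrip 0 1 :=
    ⟨by rw [ofReal_re]; positivity, by rw [ofReal_re]; exact (div_le_one hp₀).2 hqp⟩
  have hpairing : Φ ((q / p : ℝ) : ℂ) = (S : ℂ) := by
    simp only [Φ, hS, ofReal_sum]
    exact Finset.sum_congr rfl fun k _ => mul_dualPow hp₀.ne' hq₀.ne' (D k)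
  have hlines := norm_le_interp_of_mem_verticalClosedStrip' zero_lt_one hθ hΦ hbdd hleft hright
  rw [hpairing, norm_real, Real.norm_of_nonneg hS₀, ofReal_re, sub_zero, sub_zero, div_one]
    at hlines
  exact le_of_le_rpow_mul_rpow hS₀ hN₀ hC₀ hq hqp hlines

end ThreeLines

section PhaseFamily

variable {I : Type*}

/-- The analytic family of functions with `phaseFamily r F r⁻¹ = F` which moves the integrability
exponent of `F` with `re z`. -/
def phaseFamily (r : ℝ) (F : I → ℂ) (z : ℂ) (i : I) : ℂ := phasePow (F i) (r * z)

lemma differentiable_phaseFamily (r : ℝ) (F : I → ℂ) (i : I) :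
    Differentiable ℂ fun z => phaseFamily r F z i :=
  (differentiable_phasePow (F i)).comp (by fun_prop)

lemma norm_phaseFamily_le (r : ℝ) (F : I → ℂ) (z : ℂ) (i : I) :
    ‖phaseFamily r F z i‖ ≤ ‖F i‖ ^ (r * z.re) :=
  (norm_phasePow_le _ _).trans_eq (by rw [re_ofReal_mul])

lemma phaseFamily_inv {r : ℝ} (hr : r ≠ 0) (F : I → ℂ) : phaseFamily r F ((r⁻¹ : ℝ) : ℂ) = F := by
  funext i
  rw [phaseFamily, ← ofReal_mul, mul_inv_cancel₀ hr, ofReal_one, phasePow_one]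

lemma norm_phaseFamily_le_one {r : ℝ} (hr : 0 ≤ r) {F : I → ℂ} (hF : ∀ i, ‖F i‖ ≤ 1) {z : ℂ}
    (hz : 0 ≤ z.re) (i : I) : ‖phaseFamily r F z i‖ ≤ 1 :=
  (norm_phaseFamily_le r F z i).trans (Real.rpow_le_one (norm_nonneg _) (hF i) (by positivity))

lemma norm_phaseFamily_pow_le (r : ℝ) (F : I → ℂ) (n : ℕ) {z : ℂ} (hz : z.re = 1) (i : I) :
    ‖phaseFamily r F z i‖ ^ n ≤ ‖F i‖ ^ (r * n) := by
  refine (pow_le_pow_left₀ (norm_nonneg _) (norm_phaseFamily_le r F z i) n).trans_eq ?_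
  rw [hz, mul_one, Real.rpow_mul_natCast (norm_nonneg _)]

end PhaseFamily

section Normalization

variable {I : Type*} [Fintype I] {q : ℝ}

lemma norm_le_one_of_sum_norm_rpow_le_one (hq : 0 < q) {F : I → ℂ} (hF : ∑ i, ‖F i‖ ^ q ≤ 1)
    (i : I) : ‖F i‖ ≤ 1 := by
  by_contra! h
  have hle : ‖F i‖ ^ q ≤ 1 := (Finset.single_le_sum (f := fun i => ‖F i‖ ^ q)
    (fun i _ => by positivity) (Finset.mem_univ i)).trans hF
  exact hle.not_gt (Real.one_lt_rpow h hq)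

lemma exists_smul_eq_sum_norm_rpow_le_one (hq : 0 < q) (F : I → ℂ) :
    ∃ (a : ℝ) (F' : I → ℂ), 0 ≤ a ∧ F = (a : ℂ) • F' ∧ ∑ i, ‖F' i‖ ^ q ≤ 1 ∧
      a ^ q = ∑ i, ‖F i‖ ^ q := by
  have hS₀ : 0 ≤ ∑ i, ‖F i‖ ^ q := Finset.sum_nonneg fun i _ => by positivity
  set S := ∑ i, ‖F i‖ ^ q with hS
  rcases hS₀.eq_or_lt with hzero | hpos
  · refine ⟨0, 0, le_rfl, ?_, ?_, ?_⟩
    · funext i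
      have hi := (Finset.sum_eq_zero_iff_of_nonneg (fun i _ => by positivity)).1 hzero.symm i
        (Finset.mem_univ i)
      rw [Real.rpow_eq_zero (norm_nonneg _) hq.ne', norm_eq_zero] at hi
      rw [hi, ofReal_zero, zero_smul, Pi.zero_apply]
    · simp [Real.zero_rpow hq.ne']
    · rw [← hzero, Real.zero_rpow hq.ne']
  · set a := S ^ q⁻¹
    have ha : 0 < a := Real.rpow_pos_of_pos hpos _
    have haq : a ^ q = S := Real.rpow_inv_rpow hS₀ hq.ne'
    refine ⟨a, (a : ℂ)⁻¹ • F, ha.le, (smul_inv_smul₀ (ofReal_ne_zero.2 ha.ne') F).symm, ?_, haq⟩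
    simp_rw [Pi.smul_apply, norm_smul, norm_inv, norm_real, Real.norm_of_nonneg ha.le,
      Real.mul_rpow (inv_nonneg.2 ha.le) (norm_nonneg _), ← Finset.mul_sum, Real.inv_rpow ha.le,
      haq, ← hS, inv_mul_cancel₀ hpos.ne', le_refl]

end Normalization

end ComplexInterpolation

namespace FiniteGroupAverages

open ComplexInterpolation Complex.HadamardThreeLines

variable {H : Type*} [AddCommGroup H] [Fintype H] {m : ℕ} {K : Fin (m + 1) → AddSubgroup H} {p : ℝ}

lemma sum_subgroupAverage_variation_rpow_le_of_le_one (hK : Antitone K) (hp : 2 ≤ p)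
    {F G : H × H → ℂ} (hF : ∑ z, ‖F z‖ ^ (2 * p) ≤ 1) (hG : ∑ z, ‖G z‖ ^ (2 * p) ≤ 1) :
    ∑ j : Fin m, ∑ z, ‖subgroupAverage (K j.succ) F G z - subgroupAverage (K j.castSucc) F G z‖ ^ p
      ≤ 2 ^ (p - 2) * 3 := by
  have hp₀ : 0 < p / 2 := by linarith
  have hF₁ := norm_le_one_of_sum_norm_rpow_le_one (by linarith) hF
  have hG₁ := norm_le_one_of_sum_norm_rpow_le_one (by linarith) hG
  have hfour {F : H × H → ℂ} (hF : ∑ z, ‖F z‖ ^ (2 * p) ≤ 1) {s : ℂ} (hs : s.re = 1) :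
      ∑ z, ‖phaseFamily (p / 2) F s z‖ ^ 4 ≤ 1 := by
    refine (Finset.sum_le_sum fun z _ => norm_phaseFamily_pow_le (p / 2) F 4 hs z).trans ?_
    rwa [show p / 2 * (4 : ℕ) = 2 * p by push_cast; ring]
  let T (k : Fin m × (H × H)) (s : ℂ) : ℂ :=
    subgroupAverage (K k.1.succ) (phaseFamily (p / 2) F s) (phaseFamily (p / 2) G s) k.2
      - subgroupAverage (K k.1.castSucc) (phaseFamily (p / 2) F s) (phaseFamily (p / 2) G s) k.2
  have hT (k : Fin m × (H × H)) : Differentiable ℂ (T k) := by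
    have haverage (L : AddSubgroup H) (z : H × H) : Differentiable ℂ fun s =>
        subgroupAverage L (phaseFamily (p / 2) F s) (phaseFamily (p / 2) G s) z :=
      Differentiable.fun_sum fun t _ => ((differentiable_phaseFamily _ F _).mul
        (differentiable_phaseFamily _ G _)).const_mul _
    exact (haverage _ _).sub (haverage _ _)
  have hT_two (k : Fin m × (H × H)) (s : ℂ) (hs : s ∈ verticalClosedStrip 0 1) : ‖T k s‖ ≤ 2 := by
    have haverage (L : AddSubgroup H) := norm_subgroupAverage_le_one L
      (norm_phaseFamily_le_one hp₀.le hF₁ hs.1)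
      (norm_phaseFamily_le_one hp₀.le hG₁ hs.1) k.2
    exact (norm_sub_le_of_le (haverage _) (haverage _)).trans_eq one_add_one_eq_two
  have hT_sq (s : ℂ) (hs : s.re = 1) : ∑ k, ‖T k s‖ ^ (2 : ℝ) ≤ 3 := by
    simp_rw [Real.rpow_two, Fintype.sum_prod_type (α₁ := Fin m), T]
    linarith [sum_subgroupAverage_variation_sq_le hK (phaseFamily (p / 2) F s)
      (phaseFamily (p / 2) G s), hfour hF hs, hfour hG hs]
  have hmain := sum_norm_rpow_le_of_diffContOnCl (fun k => (hT k).diffContOnCl) one_lt_two hp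
    zero_le_two hT_two hT_sq
  simpa only [T, ← inv_div p 2, phaseFamily_inv hp₀.ne',
    Fintype.sum_prod_type (α₁ := Fin m)] using hmain

theorem sum_subgroupAverage_variation_rpow_le (hK : Antitone K) (hp : 2 ≤ p) (F G : H × H → ℂ) :
    ∑ j : Fin m, ∑ z, ‖subgroupAverage (K j.succ) F G z - subgroupAverage (K j.castSucc) F G z‖ ^ p
      ≤ 2 ^ (p - 2) * 3 * (∑ z, ‖F z‖ ^ (2 * p)) ^ (1 / 2 : ℝ)
        * (∑ z, ‖G z‖ ^ (2 * p)) ^ (1 / 2 : ℝ) := by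
  have hp₀ : 0 < 2 * p := by linarith
  have hroot {a : ℝ} (ha : 0 ≤ a) : (a ^ (2 * p)) ^ (1 / 2 : ℝ) = a ^ p := by
    rw [← Real.rpow_mul ha, show 2 * p * (1 / 2) = p by ring]
  obtain ⟨a, F', ha, hF, hF', hF_sum⟩ := exists_smul_eq_sum_norm_rpow_le_one hp₀ F
  obtain ⟨b, G', hb, hG, hG', hG_sum⟩ := exists_smul_eq_sum_norm_rpow_le_one hp₀ G
  have hscale (L L' : AddSubgroup H) (z : H × H) :
      ‖subgroupAverage L F G z - subgroupAverage L' F G z‖ ^ p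
        = a ^ p * b ^ p * ‖subgroupAverage L F' G' z - subgroupAverage L' F' G' z‖ ^ p := by
    rw [hF, hG, subgroupAverage_smul_smul, subgroupAverage_smul_smul, ← mul_sub, norm_mul,
      norm_mul, Complex.norm_real, Complex.norm_real, Real.norm_of_nonneg ha,
      Real.norm_of_nonneg hb, Real.mul_rpow (by positivity) (norm_nonneg _), Real.mul_rpow ha hb]
  simp_rw [hscale, ← Finset.mul_sum, ← hF_sum, ← hG_sum, hroot ha, hroot hb]
  linarith [mul_le_mul_of_nonneg_left
    (sum_subgroupAverage_variation_rpow_le_of_le_one hK hp hF' hG')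
    (show 0 ≤ a ^ p * b ^ p by positivity)]

end FiniteGroupAverages

section BaseExpansion

variable {d : ℕ}

lemma floor_pow_mul_lt_iff (hd : 0 < d) {n : ℕ} {t : ℝ≥0} :
    ⌊(d : ℝ≥0) ^ n * t⌋₊ < d ^ (2 * n) ↔ t < (d : ℝ≥0) ^ n := by
  have hpos : (0 : ℝ≥0) < (d : ℝ≥0) ^ n := by positivity
  rw [Nat.floor_lt zero_le, two_mul, pow_add, Nat.cast_mul, Nat.cast_pow,
    mul_lt_mul_iff_right₀ hpos]

lemma floor_pow_add_mul_div_pow (hd : 0 < d) (n m : ℕ) (t : ℝ≥0) :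
    ⌊(d : ℝ≥0) ^ (n + m) * t⌋₊ / d ^ m = ⌊(d : ℝ≥0) ^ n * t⌋₊ := by
  have hd₀ : (d : ℝ≥0) ^ m ≠ 0 := by positivity
  rw [← Nat.floor_div_natCast, Nat.cast_pow, pow_add, mul_right_comm, mul_div_cancel_right₀ _ hd₀]

lemma tendsto_floor_div_pow (hd : 1 < d) (t : ℝ≥0) :
    Filter.Tendsto (fun n : ℕ => ⌊(d : ℝ≥0) ^ n * t⌋₊ / (d : ℝ≥0) ^ n) Filter.atTop (nhds t) := by
  have hd₁ : (1 : ℝ≥0) < d := by exact_mod_cast hd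
  have hinv : Filter.Tendsto (fun n : ℕ => t - ((d : ℝ≥0)⁻¹) ^ n) Filter.atTop (nhds t) := by
    simpa only [tsub_zero] using tendsto_const_nhds.sub
      (NNReal.tendsto_pow_atTop_nhds_zero_of_lt_one (inv_lt_one_of_one_lt₀ hd₁))
  refine tendsto_of_tendsto_of_tendsto_of_le_of_le hinv tendsto_const_nhds (fun n => ?_) fun n => ?_
  · have hpos : (0 : ℝ≥0) < (d : ℝ≥0) ^ n := by positivity
    rw [tsub_le_iff_right, inv_pow, ← one_div, ← add_div, le_div_iff₀' hpos]
    exact (Nat.lt_floor_add_one _).le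
  · rw [div_le_iff₀' (by positivity)]
    exact Nat.floor_le zero_le

lemma eq_of_eventually_floor_pow_mul_eq (hd : 1 < d) {t t' : ℝ≥0}
    (h : ∀ᶠ n : ℕ in Filter.atTop, ⌊(d : ℝ≥0) ^ n * t⌋₊ = ⌊(d : ℝ≥0) ^ n * t'⌋₊) : t = t' :=
  tendsto_nhds_unique (tendsto_floor_div_pow hd t)
    ((tendsto_floor_div_pow hd t').congr' (h.mono fun n hn => by simp only [hn]))

lemma hasSum_maximal_fraction (hd : 1 < d) :
    HasSum (fun i : ℕ => ((d - 1 : ℕ) : ℝ≥0) * (d : ℝ≥0) ^ (-((i : ℤ) + 1))) 1 := by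
  have hd₁ : (1 : ℝ) < d := by exact_mod_cast hd
  have hsub : (d : ℝ) - 1 ≠ 0 := by linarith
  rw [← NNReal.hasSum_coe]
  have hone : ((d : ℝ) - 1) * (d : ℝ)⁻¹ * (1 - (d : ℝ)⁻¹)⁻¹ = (1 : ℝ≥0) := by
    rw [NNReal.coe_one]
    field
  rw [← hone]
  refine ((hasSum_geometric_of_lt_one (by positivity) (inv_lt_one_of_one_lt₀ hd₁)).mul_left
    _).congr_fun fun i => ?_
  rw [NNReal.coe_mul, NNReal.coe_natCast, Nat.cast_sub hd.le, Nat.cast_one, NNReal.coe_zpow,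
    NNReal.coe_natCast, zpow_neg, ← Nat.cast_add_one, zpow_natCast, pow_succ', inv_pow]
  field

section Digits

variable {c : ℕ → ℕ}

lemma digit_mul_zpow_le (hc : ∀ i, c i < d) (i : ℕ) :
    (c i : ℝ≥0) * (d : ℝ≥0) ^ (-((i : ℤ) + 1))
      ≤ ((d - 1 : ℕ) : ℝ≥0) * (d : ℝ≥0) ^ (-((i : ℤ) + 1)) := by
  gcongr
  exact Nat.le_sub_one_of_lt (hc i)

lemma summable_fraction (hd : 1 < d) (hc : ∀ i, c i < d) :
    Summable fun i => (c i : ℝ≥0) * (d : ℝ≥0) ^ (-((i : ℤ) + 1)) :=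
  NNReal.summable_of_le (digit_mul_zpow_le hc) (hasSum_maximal_fraction hd).summable

lemma tsum_fraction_lt_one (hd : 1 < d) (hc : ∀ i, c i < d) (hne : ∃ i, c i ≠ d - 1) :
    ∑' i, (c i : ℝ≥0) * (d : ℝ≥0) ^ (-((i : ℤ) + 1)) < 1 := by
  obtain ⟨i, hi⟩ := hne
  have hlt : c i < d - 1 := lt_of_le_of_ne (Nat.le_sub_one_of_lt (hc i)) hi
  rw [← (hasSum_maximal_fraction hd).tsum_eq]
  refine NNReal.tsum_lt_tsum (digit_mul_zpow_le hc) (i := i) ?_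
    (hasSum_maximal_fraction hd).summable
  gcongr

end Digits

section TwoSidedDigits

variable {c : ℤ → ℕ}

lemma floor_tsum_digits (hd : 1 < d) (hc : ∀ k, c k < d) {N : ℕ}
    (hN : ∀ i : ℕ, N ≤ i → c i = 0) (hne : ∃ i : ℕ, c (-((i : ℤ) + 1)) ≠ d - 1) :
    ⌊∑' k : ℤ, (c k : ℝ≥0) * (d : ℝ≥0) ^ k⌋₊ = ∑ i : Fin N, c i * d ^ (i : ℕ) := by
  have hint : HasSum (fun i : ℕ => (c i : ℝ≥0) * (d : ℝ≥0) ^ (i : ℤ))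
      ((∑ i : Fin N, c i * d ^ (i : ℕ) : ℕ) : ℝ≥0) := by
    rw [Fin.sum_univ_eq_sum_range fun i => c i * d ^ i, Nat.cast_sum]
    simp only [Nat.cast_mul, Nat.cast_pow, zpow_natCast]
    refine hasSum_sum_of_ne_finset_zero fun i hi => ?_
    rw [hN i (by simpa using hi), Nat.cast_zero, zero_mul]
  have hfrac : Summable fun i : ℕ =>
      (c (-((i : ℤ) + 1)) : ℝ≥0) * (d : ℝ≥0) ^ (-((i : ℤ) + 1)) :=
    summable_fraction hd fun _ => hc _
  have hlt : ∑' i : ℕ, (c (-((i : ℤ) + 1)) : ℝ≥0) * (d : ℝ≥0) ^ (-((i : ℤ) + 1)) < 1 :=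
    tsum_fraction_lt_one hd (fun _ => hc _) hne
  rw [tsum_of_nat_of_neg_add_one (f := fun k : ℤ => (c k : ℝ≥0) * (d : ℝ≥0) ^ k)
    hint.summable hfrac, hint.tsum_eq, add_comm, Nat.floor_add_natCast zero_le,
    Nat.floor_eq_zero.2 hlt, zero_add]

lemma pow_mul_tsum_digits (hd : 0 < d) (c : ℤ → ℕ) (n : ℕ) :
    (d : ℝ≥0) ^ n * ∑' k : ℤ, (c k : ℝ≥0) * (d : ℝ≥0) ^ k
      = ∑' k : ℤ, (c (k - n) : ℝ≥0) * (d : ℝ≥0) ^ k := by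
  have hd₀ : (d : ℝ≥0) ≠ 0 := by positivity
  rw [← NNReal.tsum_mul_left, ← (Equiv.subRight (n : ℤ)).tsum_eq]
  refine tsum_congr fun k => ?_
  rw [Equiv.subRight_apply, zpow_sub₀ hd₀, zpow_natCast]
  field

end TwoSidedDigits

end BaseExpansion

section HalfLine

lemma measurableEmbedding_coe_nnreal : MeasurableEmbedding ((↑) : ℝ≥0 → ℝ) :=
  MeasurableEmbedding.subtype_coe measurableSet_Ici

lemma halfLineVolume_Ico (a b : ℝ≥0) :
    halfLineVolume (Set.Ico a b) = ((b - a : ℝ≥0) : ℝ≥0∞) := by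
  have himage : ((↑) : ℝ≥0 → ℝ) '' Set.Ico a b = Set.Ico (a : ℝ) b := by
    ext x
    constructor
    · rintro ⟨y, ⟨hay, hyb⟩, rfl⟩
      exact ⟨hay, hyb⟩
    · rintro ⟨hax, hxb⟩
      exact ⟨⟨x, a.2.trans hax⟩, ⟨hax, hxb⟩, rfl⟩
  rw [halfLineVolume, measurableEmbedding_coe_nnreal.comap_apply, himage, Real.volume_Ico,
    NNReal.sub_def, ENNReal.ofReal]

lemma Ico_zero_eq_Iio (b : ℝ≥0) : Set.Ico 0 b = Set.Iio b :=
  Set.Ico_bot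

lemma halfLineVolume_Iio (b : ℝ≥0) : halfLineVolume (Set.Iio b) = b := by
  rw [← Ico_zero_eq_Iio, halfLineVolume_Ico, tsub_zero]

instance nullSingletonClass_halfLineVolume : NullSingletonClass halfLineVolume := by
  refine ⟨fun x => ?_⟩
  rw [halfLineVolume, measurableEmbedding_coe_nnreal.comap_apply, Set.image_singleton]
  exact Real.volume_singleton

end HalfLine

namespace CantorGroup

section Digits

variable {A : Type*} [AddCommGroup A] [Finite A] (e : DigitLabelling A)

lemma toEquiv_digit (t : ℝ≥0) (k : ℤ) :
    (e.toEquiv (digit e t k) : ℕ) = ⌊(Nat.card A : ℝ≥0) ^ (-k) * t⌋₊ % Nat.card A := by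
  rw [digit, Equiv.apply_symm_apply]

lemma digit_eq_zero_of_lt {t : ℝ≥0} {k : ℤ} (ht : t < (Nat.card A : ℝ≥0) ^ k) :
    digit e t k = 0 := by
  have hA : 0 < Nat.card A := Nat.card_pos
  have hlt : (Nat.card A : ℝ≥0) ^ (-k) * t < 1 := by
    rwa [zpow_neg, inv_mul_lt_one₀ (by positivity)]
  exact digit_eq_zero_of_mod_eq_zero e t k (by rw [Nat.floor_eq_zero.2 hlt, Nat.zero_mod])

lemma digit_ne_zero_of_mem_Ico {t : ℝ≥0} {k : ℤ}
    (ht : t ∈ Set.Ico ((Nat.card A : ℝ≥0) ^ k) ((Nat.card A : ℝ≥0) ^ (k + 1))) :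
    digit e t k ≠ 0 := by
  have hA : 0 < Nat.card A := Nat.card_pos
  have hpos : (0 : ℝ≥0) < (Nat.card A : ℝ≥0) ^ k := by positivity
  have hone : 1 ≤ ⌊(Nat.card A : ℝ≥0) ^ (-k) * t⌋₊ := by
    rw [Nat.one_le_floor_iff, zpow_neg, one_le_inv_mul₀ hpos]
    exact ht.1
  have hlt : ⌊(Nat.card A : ℝ≥0) ^ (-k) * t⌋₊ < Nat.card A := by
    rw [Nat.floor_lt zero_le, zpow_neg, inv_mul_lt_iff₀ hpos, ← zpow_add_one₀ (by positivity)]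
    exact ht.2
  intro hzero
  have hdigit := toEquiv_digit e t k
  rw [hzero, e.map_zero, Nat.mod_eq_of_lt hlt] at hdigit
  omega

lemma floor_eq_of_floor_eq_of_digit_eq {n : ℕ} {t t' : ℝ≥0}
    (hfloor : ⌊(Nat.card A : ℝ≥0) ^ n * t⌋₊ = ⌊(Nat.card A : ℝ≥0) ^ n * t'⌋₊)
    (hdigit : digit e t (-((n + 1 : ℕ) : ℤ)) = digit e t' (-((n + 1 : ℕ) : ℤ))) :
    ⌊(Nat.card A : ℝ≥0) ^ (n + 1) * t⌋₊ = ⌊(Nat.card A : ℝ≥0) ^ (n + 1) * t'⌋₊ := by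
  have hmod := congrArg (fun a => (e.toEquiv a : ℕ)) hdigit
  simp only [toEquiv_digit, neg_neg, zpow_natCast] at hmod
  have hdiv (s : ℝ≥0) := floor_pow_add_mul_div_pow (d := Nat.card A) Nat.card_pos n 1 s
  simp only [pow_one] at hdiv
  rw [← Nat.div_add_mod ⌊(Nat.card A : ℝ≥0) ^ (n + 1) * t⌋₊ (Nat.card A), hdiv, hfloor, hmod,
    ← hdiv, Nat.div_add_mod]

lemma eq_of_floor_eq_of_digit_eq (hd : 1 < Nat.card A) {n : ℕ} {t t' : ℝ≥0}
    (hfloor : ⌊(Nat.card A : ℝ≥0) ^ n * t⌋₊ = ⌊(Nat.card A : ℝ≥0) ^ n * t'⌋₊)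
    (hdigit : ∀ i : ℕ, digit e t (-((i : ℤ) + 1) - n) = digit e t' (-((i : ℤ) + 1) - n)) :
    t = t' := by
  refine eq_of_eventually_floor_pow_mul_eq hd (Filter.eventually_atTop.2 ⟨n, fun N hN => ?_⟩)
  induction N, hN using Nat.le_induction with
  | base => exact hfloor
  | succ N hN ih =>
    refine floor_eq_of_floor_eq_of_digit_eq e ih ?_
    convert hdigit (N - n) using 2 <;> omega

end Digits

section Cells

variable {A : Type*} [AddCommGroup A] [Finite A] (e : DigitLabelling A)

/-- The block of the digits of `t` at the positions `-n, …, n - 1`; the entry with index `i` is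
the digit at the position `i - n`. -/
def digits (n : ℕ) (t : ℝ≥0) : Fin (2 * n) → A := fun i => digit e t ((i : ℤ) - n)

/-- The integer whose base `|A|` expansion is a given block of digits. For the block of the digits
of `t < |A|ⁿ` it is the integer part of `|A|ⁿ t`. -/
def cellIndex (n : ℕ) : (Fin (2 * n) → A) ≃ Fin (Nat.card A ^ (2 * n)) :=
  (Equiv.arrowCongr (Equiv.refl _) e.toEquiv).trans finFunctionFinEquiv

lemma cellIndex_apply (n : ℕ) (h : Fin (2 * n) → A) :
    (cellIndex e n h : ℕ) = ∑ i, (e.toEquiv (h i) : ℕ) * Nat.card A ^ (i : ℕ) := rfl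

lemma toEquiv_apply_eq_cellIndex_div_mod {n : ℕ} (h : Fin (2 * n) → A) (i : Fin (2 * n)) :
    (e.toEquiv (h i) : ℕ) = cellIndex e n h / Nat.card A ^ (i : ℕ) % Nat.card A := by
  rw [← finFunctionFinEquiv_symm_apply_val, cellIndex, Equiv.trans_apply, Equiv.symm_apply_apply]
  rfl

lemma digits_eq_of_floor_eq {n : ℕ} {t : ℝ≥0} {h : Fin (2 * n) → A}
    (ht : ⌊(Nat.card A : ℝ≥0) ^ n * t⌋₊ = cellIndex e n h) : digits e n t = h := by
  have hA : (Nat.card A : ℝ≥0) ≠ 0 := by exact_mod_cast Nat.card_pos.ne'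
  funext i
  refine e.toEquiv.injective (Fin.ext ?_)
  rw [toEquiv_apply_eq_cellIndex_div_mod e h, digits, toEquiv_digit, ← ht, ← Nat.floor_div_natCast,
    Nat.cast_pow, neg_sub, zpow_sub₀ hA, zpow_natCast, zpow_natCast, div_mul_eq_mul_div]

lemma cellIndex_digits {n : ℕ} {t : ℝ≥0} (ht : t < (Nat.card A : ℝ≥0) ^ n) :
    (cellIndex e n (digits e n t) : ℕ) = ⌊(Nat.card A : ℝ≥0) ^ n * t⌋₊ := by
  obtain ⟨h, hh⟩ := (cellIndex e n).surjective ⟨_, (floor_pow_mul_lt_iff Nat.card_pos).2 ht⟩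
  have hfloor : ⌊(Nat.card A : ℝ≥0) ^ n * t⌋₊ = cellIndex e n h := by rw [hh]
  rw [digits_eq_of_floor_eq e hfloor, hfloor]

/-- The set of the points of `[0, |A|ⁿ)` with prescribed digits at the positions `-n, …, n - 1`. -/
def cell (n : ℕ) (h : Fin (2 * n) → A) : Set ℝ≥0 :=
  Set.Iio ((Nat.card A : ℝ≥0) ^ n) ∩ digits e n ⁻¹' {h}

lemma mem_cell_iff_floor_eq {n : ℕ} {h : Fin (2 * n) → A} {t : ℝ≥0} :
    t ∈ cell e n h ↔ ⌊(Nat.card A : ℝ≥0) ^ n * t⌋₊ = cellIndex e n h := by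
  constructor
  · rintro ⟨ht, rfl⟩
    exact (cellIndex_digits e ht).symm
  · intro ht
    exact ⟨(floor_pow_mul_lt_iff Nat.card_pos).1 (ht.trans_lt (cellIndex e n h).2),
      digits_eq_of_floor_eq e ht⟩

lemma cell_eq_Ico (n : ℕ) (h : Fin (2 * n) → A) :
    cell e n h = Set.Ico ((cellIndex e n h : ℕ) / (Nat.card A : ℝ≥0) ^ n)
      (((cellIndex e n h : ℕ) + 1) / (Nat.card A : ℝ≥0) ^ n) := by
  have hA : 0 < Nat.card A := Nat.card_pos
  have hpos : (0 : ℝ≥0) < (Nat.card A : ℝ≥0) ^ n := by positivity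
  ext t
  rw [mem_cell_iff_floor_eq, Nat.floor_eq_iff zero_le, Set.mem_Ico, div_le_iff₀' hpos,
    lt_div_iff₀' hpos]

lemma measurableSet_cell (n : ℕ) (h : Fin (2 * n) → A) : MeasurableSet (cell e n h) := by
  rw [cell_eq_Ico]
  exact measurableSet_Ico

lemma halfLineVolume_cell (n : ℕ) (h : Fin (2 * n) → A) :
    halfLineVolume (cell e n h) = ((((Nat.card A : ℝ≥0) ^ n)⁻¹ : ℝ≥0) : ℝ≥0∞) := by
  rw [cell_eq_Ico, halfLineVolume_Ico, ← NNReal.sub_div, add_tsub_cancel_left, one_div]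

/-- The blocks of digits that vanish at the positions `≥ -k`, that is, the blocks of digits of the
points of `[0, |A|⁻ᵏ)`. -/
def blockSubgroup (A : Type*) [AddCommGroup A] (n : ℕ) (k : ℤ) :
    AddSubgroup (Fin (2 * n) → A) where
  carrier := {h | ∀ i : Fin (2 * n), -k ≤ (i : ℤ) - n → h i = 0}
  zero_mem' := fun _ _ => rfl
  add_mem' := fun ha hb i hi => by rw [Pi.add_apply, ha i hi, hb i hi, add_zero]
  neg_mem' := fun ha i hi => by rw [Pi.neg_apply, ha i hi, neg_zero]

lemma antitone_blockSubgroup (A : Type*) [AddCommGroup A] (n : ℕ) : Antitone (blockSubgroup A n) :=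
  fun _ _ hkl _ ha i hi => ha i ((neg_le_neg hkl).trans hi)

lemma digits_mem_blockSubgroup_iff (hd : 1 < Nat.card A) {n : ℕ} {k : ℤ} {t : ℝ≥0}
    (hk : k ≤ n) (ht : t < (Nat.card A : ℝ≥0) ^ n) :
    digits e n t ∈ blockSubgroup A n k ↔ t < (Nat.card A : ℝ≥0) ^ (-k) := by
  have hd₁ : (1 : ℝ≥0) < Nat.card A := by exact_mod_cast hd
  refine ⟨fun hmem => ?_, fun hlt i hi =>
    digit_eq_zero_of_lt e (hlt.trans_le (zpow_le_zpow_right₀ hd₁.le hi))⟩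
  by_contra! hle
  have ht₀ : t ≠ 0 := (lt_of_lt_of_le (by positivity) hle).ne'
  obtain ⟨j, hj⟩ := NNReal.exists_mem_Ico_zpow ht₀ hd₁
  have hkj : -k < j + 1 := (zpow_lt_zpow_iff_right₀ hd₁).1 (hle.trans_lt hj.2)
  have hjn : j < n := by
    rw [← zpow_natCast] at ht
    exact (zpow_lt_zpow_iff_right₀ hd₁).1 (hj.1.trans_lt ht)
  have hpos : (((j + n).toNat : ℕ) : ℤ) - n = j := by omega
  have hzero := hmem ⟨(j + n).toNat, by omega⟩ (by rw [hpos]; omega)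
  rw [digits, hpos] at hzero
  exact digit_ne_zero_of_mem_Ico e hj hzero

end Cells

section DigitwiseAddition

variable {A : Type*} [AddCommGroup A] [Finite A] (e : DigitLabelling A)

lemma iota_mem_cell (hd : 1 < Nat.card A) {n : ℕ} (s : seqGroup A)
    (hs : ∀ k : ℤ, (n : ℤ) ≤ k → (s : ℤ → A) k = 0)
    (hmax : ∃ i : ℕ, (e.toEquiv ((s : ℤ → A) (-((i : ℤ) + 1) - n)) : ℕ) ≠ Nat.card A - 1) :
    iota e s ∈ cell e n fun i => (s : ℤ → A) ((i : ℤ) - n) := by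
  rw [mem_cell_iff_floor_eq, cellIndex_apply, iota,
    pow_mul_tsum_digits Nat.card_pos fun k => (e.toEquiv ((s : ℤ → A) k) : ℕ)]
  refine floor_tsum_digits hd (c := fun k => (e.toEquiv ((s : ℤ → A) (k - n)) : ℕ))
    (fun k => Fin.is_lt _) (fun i hi => ?_) hmax
  rw [hs _ (by omega), e.map_zero]

/-- The exceptional `t` are determined by their integer part and by the fact that the digits of
`x` and `t` add up to the maximal digit, so there are only countably many of them. -/
lemma ae_exists_digit_add_ne (hd : 1 < Nat.card A) (n : ℕ) (x : ℝ≥0) :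
    ∀ᵐ t ∂halfLineVolume, ∃ i : ℕ,
      (e.toEquiv (digit e x (-((i : ℤ) + 1) - n) + digit e t (-((i : ℤ) + 1) - n)) : ℕ)
        ≠ Nat.card A - 1 := by
  refine Set.Countable.measure_zero ?_ _
  refine Set.MapsTo.countable_of_injOn (f := fun t => ⌊(Nat.card A : ℝ≥0) ^ n * t⌋₊)
    (t := Set.univ) (Set.mapsTo_univ _ _) (fun t ht t' ht' hfloor => ?_) (Set.to_countable _)
  simp only [Set.mem_compl_iff, Set.mem_ofPred_eq, not_exists, not_not] at ht ht'
  exact eq_of_floor_eq_of_digit_eq e hd hfloor fun i =>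
    add_left_cancel (e.toEquiv.injective (Fin.ext ((ht i).trans (ht' i).symm)))

lemma ae_oplus_mem_cell (hd : 1 < Nat.card A) {n : ℕ} {x : ℝ≥0}
    (hx : x < (Nat.card A : ℝ≥0) ^ n) :
    ∀ᵐ t ∂halfLineVolume, t < (Nat.card A : ℝ≥0) ^ n →
      oplus e x t ∈ cell e n (digits e n x + digits e n t) := by
  filter_upwards [ae_exists_digit_add_ne e hd n x] with t hmax ht
  refine iota_mem_cell e hd (kappa e x + kappa e t) (fun k hk => ?_) hmax
  have hle : (Nat.card A : ℝ≥0) ^ n ≤ (Nat.card A : ℝ≥0) ^ k := by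
    rw [← zpow_natCast]
    exact zpow_le_zpow_right₀ (by exact_mod_cast hd.le) hk
  change digit e x k + digit e t k = 0
  rw [digit_eq_zero_of_lt e (hx.trans_le hle), digit_eq_zero_of_lt e (ht.trans_le hle), add_zero]

end DigitwiseAddition

end CantorGroup

section FiniteRange

variable {α β E : Type*} {s : Set α} {f : α → β}

lemma indicator_comp_eq_sum_indicator [Fintype β] [AddCommMonoid E] (s : Set α) (f : α → β)
    (φ : β → E) (a : α) :
    s.indicator (fun a => φ (f a)) a = ∑ b, (s ∩ f ⁻¹' {b}).indicator (fun _ => φ b) a := by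
  classical
  by_cases ha : a ∈ s
  · simp [Set.indicator, ha]
  · simp [ha]

variable [MeasurableSpace α]

lemma measurable_indicator_comp [Finite β] [AddCommMonoid E] [MeasurableSpace E] [MeasurableAdd₂ E]
    (hs : ∀ b, MeasurableSet (s ∩ f ⁻¹' {b})) (φ : β → E) :
    Measurable (s.indicator fun a => φ (f a)) := by
  cases nonempty_fintype β
  rw [funext (indicator_comp_eq_sum_indicator s f φ)]
  exact Finset.measurable_fun_sum _ fun b _ => measurable_const.indicator (hs b)

variable {μ : Measure α} [Fintype β]

lemma lintegral_indicator_comp (hs : ∀ b, MeasurableSet (s ∩ f ⁻¹' {b})) (φ : β → ℝ≥0∞) :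
    ∫⁻ a, s.indicator (fun a => φ (f a)) a ∂μ = ∑ b, φ b * μ (s ∩ f ⁻¹' {b}) := by
  simp_rw [indicator_comp_eq_sum_indicator s f φ]
  rw [lintegral_finsetSum _ fun b _ => measurable_const.indicator (hs b)]
  exact Finset.sum_congr rfl fun b _ => lintegral_indicator_const (hs b) (φ b)

lemma setIntegral_comp [NormedAddCommGroup E] [NormedSpace ℝ E] [CompleteSpace E]
    (hs : ∀ b, MeasurableSet (s ∩ f ⁻¹' {b})) (hμ : ∀ b, μ (s ∩ f ⁻¹' {b}) ≠ ∞) (φ : β → E) :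
    ∫ a in s, φ (f a) ∂μ = ∑ b, μ.real (s ∩ f ⁻¹' {b}) • φ b := by
  have hs_eq : s = ⋃ b, s ∩ f ⁻¹' {b} := by
    rw [← Set.inter_iUnion, ← Set.preimage_iUnion, Set.iUnion_of_singleton, Set.preimage_univ,
      Set.inter_univ]
  have hs_meas : MeasurableSet s := hs_eq ▸ MeasurableSet.iUnion hs
  rw [← integral_indicator hs_meas]
  simp_rw [indicator_comp_eq_sum_indicator s f φ]
  rw [integral_finsetSum _ fun b _ =>
    (integrable_indicator_iff (hs b)).2 (integrableOn_const (hμ b))]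
  exact Finset.sum_congr rfl fun b _ => integral_indicator_const (φ b) (hs b)

end FiniteRange

lemma enorm_rpow_eq_ofReal {E : Type*} [NormedAddCommGroup E] (x : E) {q : ℝ} (hq : 0 ≤ q) :
    ‖x‖ₑ ^ q = ENNReal.ofReal (‖x‖ ^ q) := by
  rw [← ofReal_norm, ENNReal.ofReal_rpow_of_nonneg (norm_nonneg _) hq]

/-- The square `[0, dⁿ)²`. -/
def square (d n : ℕ) : Set (ℝ≥0 × ℝ≥0) :=
  Set.Iio ((d : ℝ≥0) ^ n) ×ˢ Set.Iio ((d : ℝ≥0) ^ n)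

namespace CantorGroup

open FiniteGroupAverages

section BlockAverages

variable {A : Type*} [AddCommGroup A] [Fintype A] (e : DigitLabelling A)

lemma setIntegral_comp_digits (n : ℕ) (φ : (Fin (2 * n) → A) → ℂ) :
    ∫ t in Set.Iio ((Nat.card A : ℝ≥0) ^ n), φ (digits e n t) ∂halfLineVolume
      = ((Nat.card A : ℂ) ^ n)⁻¹ * ∑ h, φ h := by
  rw [setIntegral_comp (measurableSet_cell e n)
    (fun h => by rw [← cell, halfLineVolume_cell]; exact ENNReal.coe_ne_top), Finset.mul_sum]
  refine Finset.sum_congr rfl fun h _ => ?_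
  rw [← cell, Measure.real, halfLineVolume_cell, ENNReal.coe_toReal, Complex.real_smul]
  push_cast
  rfl

open Classical in
lemma setIntegral_Iio_zpow_comp_digits (hd : 1 < Nat.card A) {n : ℕ} {k : ℤ}
    (hk : k ∈ Set.Icc (-n : ℤ) n) (φ : (Fin (2 * n) → A) → ℂ) :
    ∫ t in Set.Iio ((Nat.card A : ℝ≥0) ^ (-k)), φ (digits e n t) ∂halfLineVolume
      = ((Nat.card A : ℂ) ^ n)⁻¹ * ∑ h, if h ∈ blockSubgroup A n k then φ h else 0 := by
  have hsub : Set.Iio ((Nat.card A : ℝ≥0) ^ (-k)) ⊆ Set.Iio ((Nat.card A : ℝ≥0) ^ n) := by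
    refine Set.Iio_subset_Iio ?_
    rw [← zpow_natCast]
    exact zpow_le_zpow_right₀ (by exact_mod_cast hd.le) (neg_le.1 hk.1)
  rw [← setIntegral_comp_digits e, ← Set.inter_eq_right.2 hsub,
    ← setIntegral_indicator measurableSet_Iio]
  refine setIntegral_congr_fun measurableSet_Iio fun t ht => ?_
  simp only [Set.indicator, Set.mem_Iio, digits_mem_blockSubgroup_iff e hd hk.2 ht]

lemma zpow_mul_setIntegral_comp_digits (hd : 1 < Nat.card A) {n : ℕ} {k : ℤ}
    (hk : k ∈ Set.Icc (-n : ℤ) n) (φ : (Fin (2 * n) → A) → ℂ) :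
    (Nat.card A : ℂ) ^ k
        * ∫ t in Set.Iio ((Nat.card A : ℝ≥0) ^ (-k)), φ (digits e n t) ∂halfLineVolume
      = ∑ h, (uniformDensity (blockSubgroup A n k) h : ℂ) * φ h := by
  classical
  have hA : (Nat.card A : ℂ) ≠ 0 := by exact_mod_cast Nat.card_pos.ne'
  have hcard : (Nat.card A : ℂ) ^ (-k)
      = ((Nat.card A : ℂ) ^ n)⁻¹ * Nat.card (blockSubgroup A n k) := by
    have h := setIntegral_Iio_zpow_comp_digits e hd hk fun _ => 1
    rw [setIntegral_const, Measure.real, halfLineVolume_Iio, ENNReal.coe_toReal,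
      Finset.sum_boole, ← Fintype.card_subtype, ← Nat.card_eq_fintype_card] at h
    simpa using h
  have hdensity : (Nat.card A : ℂ) ^ k * ((Nat.card A : ℂ) ^ n)⁻¹
      = (Nat.card (blockSubgroup A n k) : ℂ)⁻¹ := by
    have hK : (Nat.card (blockSubgroup A n k) : ℂ) ≠ 0 := by exact_mod_cast Nat.card_pos.ne'
    rw [← inv_inv ((Nat.card A : ℂ) ^ k), ← zpow_neg, hcard]
    field
  rw [setIntegral_Iio_zpow_comp_digits e hd hk, ← mul_assoc, hdensity, Finset.mul_sum]
  refine Finset.sum_congr rfl fun h _ => ?_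
  rw [uniformDensity]
  split_ifs <;> simp

end BlockAverages

section StepFunctions

variable {A : Type*} [AddCommGroup A] [Finite A] (e : DigitLabelling A) {E : Type*} [Zero E]

/-- The function on `[0, |A|ⁿ)²`, extended by zero, that is given by a function of the blocks of
digits of the two coordinates. -/
def stepFun (n : ℕ) (φ : (Fin (2 * n) → A) × (Fin (2 * n) → A) → E) : ℝ≥0 × ℝ≥0 → E :=
  (square (Nat.card A) n).indicator fun z => φ (digits e n z.1, digits e n z.2)

variable {n : ℕ} (φ : (Fin (2 * n) → A) × (Fin (2 * n) → A) → E)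

lemma stepFun_of_mem_cell {x y : ℝ≥0} {h h' : Fin (2 * n) → A} (hx : x ∈ cell e n h)
    (hy : y ∈ cell e n h') : stepFun e n φ (x, y) = φ (h, h') := by
  rw [stepFun, Set.indicator_of_mem (show (x, y) ∈ square (Nat.card A) n from ⟨hx.1, hy.1⟩),
    show digits e n x = h from hx.2, show digits e n y = h' from hy.2]

lemma stepFun_of_notMem {z : ℝ≥0 × ℝ≥0} (hz : z ∉ square (Nat.card A) n) : stepFun e n φ z = 0 :=
  Set.indicator_of_notMem hz _

lemma comp_stepFun {E' : Type*} [Zero E'] {g : E → E'} (hg : g 0 = 0) (z : ℝ≥0 × ℝ≥0) :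
    g (stepFun e n φ z) = stepFun e n (fun h => g (φ h)) z :=
  congrFun (Set.indicator_comp_of_zero hg).symm z

lemma square_inter_preimage_digits (h : (Fin (2 * n) → A) × (Fin (2 * n) → A)) :
    square (Nat.card A) n ∩ (fun z : ℝ≥0 × ℝ≥0 => (digits e n z.1, digits e n z.2)) ⁻¹' {h}
      = cell e n h.1 ×ˢ cell e n h.2 := by
  ext z
  simp only [square, cell, Set.mem_inter_iff, Set.mem_prod, Set.mem_preimage,
    Set.mem_singleton_iff, Prod.ext_iff]
  exact and_and_and_comm

lemma measurableSet_square_inter_preimage_digits (h : (Fin (2 * n) → A) × (Fin (2 * n) → A)) :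
    MeasurableSet (square (Nat.card A) n
      ∩ (fun z : ℝ≥0 × ℝ≥0 => (digits e n z.1, digits e n z.2)) ⁻¹' {h}) := by
  rw [square_inter_preimage_digits]
  exact (measurableSet_cell e n _).prod (measurableSet_cell e n _)

lemma measurable_stepFun {E : Type*} [AddCommMonoid E] [MeasurableSpace E] [MeasurableAdd₂ E]
    (φ : (Fin (2 * n) → A) × (Fin (2 * n) → A) → E) : Measurable (stepFun e n φ) :=
  measurable_indicator_comp (measurableSet_square_inter_preimage_digits e) φ

lemma bilinearAverage_eq_zero_of_notMem_square {F G : ℝ≥0 × ℝ≥0 → ℂ}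
    (hF : ∀ z, z ∉ square (Nat.card A) n → F z = 0)
    (hG : ∀ z, z ∉ square (Nat.card A) n → G z = 0) (k : ℤ) {z : ℝ≥0 × ℝ≥0}
    (hz : z ∉ square (Nat.card A) n) : bilinearAverage e k F G z = 0 := by
  have hprod (t : ℝ≥0) : F (oplus e z.1 t, z.2) * G (z.1, oplus e z.2 t) = 0 := by
    by_cases hy : z.2 < (Nat.card A : ℝ≥0) ^ n
    · rw [hG (z.1, oplus e z.2 t) fun h => hz ⟨h.1, hy⟩, mul_zero]
    · rw [hF (oplus e z.1 t, z.2) fun h => hy h.2, zero_mul]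
  simp only [bilinearAverage, hprod, integral_zero, mul_zero]

end StepFunctions

section Transfer

variable {A : Type*} [AddCommGroup A] [Fintype A] (e : DigitLabelling A) {n : ℕ}

lemma lintegral_stepFun (φ : (Fin (2 * n) → A) × (Fin (2 * n) → A) → ℝ≥0∞) :
    ∫⁻ z, stepFun e n φ z ∂quarterPlaneVolume
      = ((((Nat.card A : ℝ≥0) ^ n)⁻¹ : ℝ≥0) : ℝ≥0∞) ^ 2 * ∑ h, φ h := by
  simp_rw [stepFun]
  rw [lintegral_indicator_comp (measurableSet_square_inter_preimage_digits e), Finset.mul_sum]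
  refine Finset.sum_congr rfl fun h _ => ?_
  rw [square_inter_preimage_digits, quarterPlaneVolume, Measure.prod_prod, halfLineVolume_cell,
    halfLineVolume_cell, mul_comm, sq]

lemma lintegral_enorm_stepFun_rpow (f : (Fin (2 * n) → A) × (Fin (2 * n) → A) → ℂ) {q : ℝ}
    (hq : 0 < q) :
    ∫⁻ z, ‖stepFun e n f z‖ₑ ^ q ∂quarterPlaneVolume
      = ((((Nat.card A : ℝ≥0) ^ n)⁻¹ : ℝ≥0) : ℝ≥0∞) ^ 2 * ENNReal.ofReal (∑ h, ‖f h‖ ^ q) := by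
  have hzero : ‖(0 : ℂ)‖ₑ ^ q = 0 := by rw [enorm_zero, ENNReal.zero_rpow_of_pos hq]
  simp_rw [comp_stepFun e f (g := fun w => ‖w‖ₑ ^ q) hzero, lintegral_stepFun,
    enorm_rpow_eq_ofReal _ hq.le]
  rw [ENNReal.ofReal_sum_of_nonneg fun h _ => by positivity]

lemma rpow_half_lintegral_enorm_stepFun_rpow (f : (Fin (2 * n) → A) × (Fin (2 * n) → A) → ℂ)
    {q : ℝ} (hq : 0 < q) :
    (∫⁻ z, ‖stepFun e n f z‖ₑ ^ q ∂quarterPlaneVolume) ^ (1 / 2 : ℝ)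
      = ((((Nat.card A : ℝ≥0) ^ n)⁻¹ : ℝ≥0) : ℝ≥0∞)
        * ENNReal.ofReal ((∑ h, ‖f h‖ ^ q) ^ (1 / 2 : ℝ)) := by
  rw [lintegral_enorm_stepFun_rpow e f hq, ENNReal.mul_rpow_of_nonneg _ _ (by norm_num),
    ENNReal.ofReal_rpow_of_nonneg (by positivity) (by norm_num), ← ENNReal.rpow_natCast,
    ← ENNReal.rpow_mul]
  norm_num

lemma bilinearAverage_stepFun (hd : 1 < Nat.card A) {k : ℤ} (hk : k ∈ Set.Icc (-n : ℤ) n)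
    (f g : (Fin (2 * n) → A) × (Fin (2 * n) → A) → ℂ) :
    bilinearAverage e k (stepFun e n f) (stepFun e n g)
      = stepFun e n (subgroupAverage (blockSubgroup A n k) f g) := by
  funext ⟨x, y⟩
  by_cases hz : (x, y) ∈ square (Nat.card A) n
  swap
  · rw [stepFun_of_notMem e _ hz, bilinearAverage_eq_zero_of_notMem_square e
      (fun _ => stepFun_of_notMem e f) (fun _ => stepFun_of_notMem e g) k hz]
  have hx : x ∈ cell e n (digits e n x) := ⟨hz.1, rfl⟩
  have hy : y ∈ cell e n (digits e n y) := ⟨hz.2, rfl⟩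
  have hle : (Nat.card A : ℝ≥0) ^ (-k) ≤ (Nat.card A : ℝ≥0) ^ n := by
    rw [← zpow_natCast]
    exact zpow_le_zpow_right₀ (by exact_mod_cast hd.le) (neg_le.1 hk.1)
  rw [stepFun_of_mem_cell e _ hx hy, subgroupAverage,
    ← zpow_mul_setIntegral_comp_digits e hd hk fun h =>
      f (digits e n x + h, digits e n y) * g (digits e n x, digits e n y + h),
    bilinearAverage, Ico_zero_eq_Iio]
  congr 1
  refine setIntegral_congr_ae measurableSet_Iio ?_
  filter_upwards [ae_oplus_mem_cell e hd hz.1, ae_oplus_mem_cell e hd hz.2] with t hxt hyt ht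
  have htn := (Set.mem_Iio.1 ht).trans_le hle
  rw [stepFun_of_mem_cell e f (hxt htn) hy, stepFun_of_mem_cell e g hx (hyt htn)]

end Transfer

variable {A : Type*} [AddCommGroup A] [Finite A] (e : DigitLabelling A) {n : ℕ}

theorem lintegral_variation_stepFun_le (hd : 1 < Nat.card A) {p : ℝ} (hp : 2 ≤ p) {m : ℕ}
    {k : Fin (m + 1) → ℤ} (hk : Monotone k) (hkn : ∀ j, k j ∈ Set.Icc (-n : ℤ) n)
    (f g : (Fin (2 * n) → A) × (Fin (2 * n) → A) → ℂ) :
    ∑ j : Fin m, ∫⁻ z, ‖bilinearAverage e (k j.succ) (stepFun e n f) (stepFun e n g) z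
        - bilinearAverage e (k j.castSucc) (stepFun e n f) (stepFun e n g) z‖ₑ ^ p
          ∂quarterPlaneVolume
      ≤ ENNReal.ofReal (2 ^ (p - 2) * 3)
        * (∫⁻ z, ‖stepFun e n f z‖ₑ ^ (2 * p) ∂quarterPlaneVolume) ^ (1 / 2 : ℝ)
        * (∫⁻ z, ‖stepFun e n g z‖ₑ ^ (2 * p) ∂quarterPlaneVolume) ^ (1 / 2 : ℝ) := by
  cases nonempty_fintype A
  have hp₀ : 0 < p := by linarith
  set c : ℝ≥0∞ := ((((Nat.card A : ℝ≥0) ^ n)⁻¹ : ℝ≥0) : ℝ≥0∞)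
  let T (j : Fin (m + 1)) := subgroupAverage (blockSubgroup A n (k j)) f g
  have hdiff (j : Fin m) (z : ℝ≥0 × ℝ≥0) :
      bilinearAverage e (k j.succ) (stepFun e n f) (stepFun e n g) z
        - bilinearAverage e (k j.castSucc) (stepFun e n f) (stepFun e n g) z
      = stepFun e n (fun h => T j.succ h - T j.castSucc h) z := by
    rw [bilinearAverage_stepFun e hd (hkn _), bilinearAverage_stepFun e hd (hkn _)]
    exact (congrFun (Set.indicator_sub _ _ _) z).symm
  simp_rw [hdiff, lintegral_enorm_stepFun_rpow e _ hp₀,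
    rpow_half_lintegral_enorm_stepFun_rpow e _ (show 0 < 2 * p by positivity)]
  have hvariation := ENNReal.ofReal_le_ofReal (sum_subgroupAverage_variation_rpow_le
    ((antitone_blockSubgroup A n).comp_monotone hk) hp f g)
  calc ∑ j : Fin m, c ^ 2 * ENNReal.ofReal (∑ h, ‖T j.succ h - T j.castSucc h‖ ^ p)
      = c ^ 2 * ENNReal.ofReal (∑ j : Fin m, ∑ h, ‖T j.succ h - T j.castSucc h‖ ^ p) := by
        rw [ENNReal.ofReal_sum_of_nonneg fun j _ => by positivity, Finset.mul_sum]
    _ ≤ c ^ 2 * ENNReal.ofReal (2 ^ (p - 2) * 3 * (∑ h, ‖f h‖ ^ (2 * p)) ^ (1 / 2 : ℝ)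
          * (∑ h, ‖g h‖ ^ (2 * p)) ^ (1 / 2 : ℝ)) := mul_le_mul_right hvariation _
    _ = _ := by
        rw [ENNReal.ofReal_mul (by positivity), ENNReal.ofReal_mul (by positivity)]
        ring

end CantorGroup

namespace CantorGroup

variable {A : Type*} [AddCommGroup A] [Finite A] (e : DigitLabelling A)

lemma measurable_oplus (x : ℝ≥0) : Measurable (oplus e x) := by
  let digitOfNat (N : ℕ) : A := e.toEquiv.symm ⟨N % Nat.card A, Nat.mod_lt _ Nat.card_pos⟩
  have hfloor (k : ℤ) : Measurable fun t : ℝ≥0 => ⌊(Nat.card A : ℝ≥0) ^ (-k) * t⌋₊ :=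
    Nat.measurable_floor.comp (measurable_const_mul _)
  exact Measurable.tsum fun k => Measurable.mul_const ((measurable_of_countable fun N =>
    ((e.toEquiv (digit e x k + digitOfNat N) : ℕ) : ℝ≥0)).comp (hfloor k)) _

lemma cell_subset_cell {n n' : ℕ} (hn : n ≤ n') {h : Fin (2 * n) → A} {h' : Fin (2 * n') → A}
    (hne : (cell e n h ∩ cell e n' h').Nonempty) : cell e n' h' ⊆ cell e n h := by
  obtain ⟨m, rfl⟩ := Nat.exists_eq_add_of_le hn
  obtain ⟨t, ht, ht'⟩ := hne
  intro s hs
  rw [mem_cell_iff_floor_eq] at ht ht' hs ⊢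
  rw [← ht, ← floor_pow_add_mul_div_pow Nat.card_pos n m, hs, ← ht',
    floor_pow_add_mul_div_pow Nat.card_pos]

lemma isPiSystem_cell (n₀ : ℕ) : IsPiSystem {S | ∃ n ≥ n₀, ∃ h, cell e n h = S} := by
  rintro _ ⟨n₁, hn₁, h₁, rfl⟩ _ ⟨n₂, hn₂, h₂, rfl⟩ hne
  rcases le_total n₁ n₂ with hle | hle
  · exact ⟨n₂, hn₂, h₂, (Set.inter_eq_right.2 (cell_subset_cell e hle hne)).symm⟩
  · rw [Set.inter_comm] at hne
    exact ⟨n₁, hn₁, h₁, (Set.inter_eq_left.2 (cell_subset_cell e hle hne)).symm⟩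

lemma measurable_of_measurableSet_preimage_cell (hd : 1 < Nat.card A) {n₀ : ℕ} {α : Type*}
    [MeasurableSpace α] {f : α → ℝ≥0} (hf : ∀ n ≥ n₀, ∀ h, MeasurableSet (f ⁻¹' cell e n h)) :
    Measurable f := by
  let truncation (n : ℕ) : α → ℝ≥0 := (f ⁻¹' Set.Iio ((Nat.card A : ℝ≥0) ^ n)).indicator fun a =>
    (cellIndex e n (digits e n (f a)) : ℕ) / (Nat.card A : ℝ≥0) ^ n
  have hmeas (n : ℕ) : Measurable (truncation (n + n₀)) :=
    measurable_indicator_comp (f := fun a => digits e (n + n₀) (f a))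
      (hf (n + n₀) (Nat.le_add_left _ _))
      fun h => (cellIndex e (n + n₀) h : ℕ) / (Nat.card A : ℝ≥0) ^ (n + n₀)
  have hlim (a : α) : Filter.Tendsto (truncation · a) Filter.atTop (nhds (f a)) := by
    obtain ⟨N, hN⟩ := pow_unbounded_of_one_lt (f a) (by exact_mod_cast hd : (1 : ℝ≥0) < Nat.card A)
    refine (tendsto_floor_div_pow hd (f a)).congr' (Filter.eventually_atTop.2 ⟨N, fun n hn => ?_⟩)
    have ha : f a < (Nat.card A : ℝ≥0) ^ n :=
      hN.trans_le (pow_le_pow_right₀ (by exact_mod_cast hd.le) hn)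
    simp only [truncation, Set.indicator_of_mem (Set.mem_preimage.2 (Set.mem_Iio.2 ha)),
      cellIndex_digits e ha]
  exact measurable_of_tendsto_metrizable hmeas (tendsto_pi_nhds.2 fun a =>
    (hlim a).comp (Filter.tendsto_add_atTop_nat n₀))

lemma generateFrom_cell (hd : 1 < Nat.card A) (n₀ : ℕ) :
    MeasurableSpace.generateFrom {S | ∃ n ≥ n₀, ∃ h, cell e n h = S} = NNReal.measurableSpace := by
  apply le_antisymm
  · refine MeasurableSpace.generateFrom_le ?_
    rintro _ ⟨n, -, h, rfl⟩
    exact measurableSet_cell e n h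
  · rw [← MeasurableSpace.comap_id (m := NNReal.measurableSpace)]
    exact (@measurable_of_measurableSet_preimage_cell A _ _ e hd n₀ ℝ≥0
      (MeasurableSpace.generateFrom {S | ∃ n ≥ n₀, ∃ h, cell e n h = S}) id fun n hn h =>
        MeasurableSpace.measurableSet_generateFrom ⟨n, hn, h, rfl⟩).comap_le

open Classical in
lemma halfLineVolume_restrict_Iio_cell (hd : 1 < Nat.card A) {n N : ℕ} (h : Fin (2 * N) → A) :
    halfLineVolume.restrict (Set.Iio ((Nat.card A : ℝ≥0) ^ n)) (cell e N h)
      = if h ∈ blockSubgroup A N (-n) then ((((Nat.card A : ℝ≥0) ^ N)⁻¹ : ℝ≥0) : ℝ≥0∞) else 0 := by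
  have hmem {t : ℝ≥0} (ht : t ∈ cell e N h) :
      h ∈ blockSubgroup A N (-n) ↔ t < (Nat.card A : ℝ≥0) ^ n := by
    rw [← show digits e N t = h from ht.2, digits_mem_blockSubgroup_iff e hd (by lia) ht.1,
      neg_neg, zpow_natCast]
  rw [Measure.restrict_apply (measurableSet_cell e N h)]
  split_ifs with hh
  · have hsub : cell e N h ⊆ Set.Iio ((Nat.card A : ℝ≥0) ^ n) := fun t ht => (hmem ht).1 hh
    rw [Set.inter_eq_left.2 hsub, halfLineVolume_cell]
  · have hdisj : Disjoint (cell e N h) (Set.Iio ((Nat.card A : ℝ≥0) ^ n)) :=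
      Set.disjoint_left.2 fun t ht htn => hh ((hmem ht).2 htn)
    rw [hdisj.inter_eq, measure_empty]

lemma ae_oplus_mem_cell_iff (hd : 1 < Nat.card A) {n : ℕ} {x : ℝ≥0}
    (hx : x < (Nat.card A : ℝ≥0) ^ n) (h : Fin (2 * n) → A) :
    ∀ᵐ t ∂halfLineVolume, t < (Nat.card A : ℝ≥0) ^ n →
      (oplus e x t ∈ cell e n h ↔ t ∈ cell e n (h - digits e n x)) := by
  filter_upwards [ae_oplus_mem_cell e hd hx] with t ht htn
  have hsum : digits e n (oplus e x t) = digits e n x + digits e n t := (ht htn).2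
  simp only [cell, Set.mem_inter_iff, Set.mem_Iio, Set.mem_preimage, Set.mem_singleton_iff,
    (ht htn).1.out, htn, hsum, true_and, eq_sub_iff_add_eq']

lemma measurePreserving_oplus (hd : 1 < Nat.card A) {n : ℕ} {x : ℝ≥0}
    (hx : x < (Nat.card A : ℝ≥0) ^ n) :
    MeasurePreserving (oplus e x)
      (halfLineVolume.restrict (Set.Iio ((Nat.card A : ℝ≥0) ^ n)))
      (halfLineVolume.restrict (Set.Iio ((Nat.card A : ℝ≥0) ^ n))) := by
  classical
  have hfin : IsFiniteMeasure (halfLineVolume.restrict (Set.Iio ((Nat.card A : ℝ≥0) ^ n))) :=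
    ⟨by rw [Measure.restrict_apply_univ, halfLineVolume_Iio]; exact ENNReal.coe_lt_top⟩
  refine ⟨measurable_oplus e x, (ext_of_generate_finite _ (generateFrom_cell e hd n).symm
    (isPiSystem_cell e n) ?_ ?_).symm⟩
  · rintro _ ⟨N, hN, h, rfl⟩
    have hle : (Nat.card A : ℝ≥0) ^ n ≤ (Nat.card A : ℝ≥0) ^ N :=
      pow_le_pow_right₀ (by exact_mod_cast hd.le) hN
    have hxN := hx.trans_le hle
    have hdigits : digits e N x ∈ blockSubgroup A N (-n) := by
      rwa [digits_mem_blockSubgroup_iff e hd (by lia) hxN, neg_neg, zpow_natCast]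
    rw [Measure.map_apply (measurable_oplus e x) (measurableSet_cell e N h)]
    trans halfLineVolume.restrict (Set.Iio ((Nat.card A : ℝ≥0) ^ n))
      (cell e N (h - digits e N x))
    · rw [halfLineVolume_restrict_Iio_cell e hd, halfLineVolume_restrict_Iio_cell e hd,
        sub_eq_add_neg, AddSubgroup.add_mem_cancel_right _ (neg_mem hdigits)]
    · refine measure_congr (Filter.Eventually.set_eq ?_)
      filter_upwards [ae_restrict_of_ae (ae_oplus_mem_cell_iff e hd hxN h),
        ae_restrict_mem measurableSet_Iio] with t ht htn
      exact (ht (htn.out.trans_le hle)).symm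
  · rw [Measure.map_apply (measurable_oplus e x) MeasurableSet.univ, Set.preimage_univ]

end CantorGroup

/-- Convergence almost everywhere of measurable functions that are uniformly bounded and vanish
off a fixed set. -/
structure TendstoBoundedly {α E : Type*} [MeasurableSpace α] [NormedAddCommGroup E]
    [MeasurableSpace E] (μ : Measure α) (s : Set α) (f : ℕ → α → E) (g : α → E) : Prop where
  measurable : ∀ i, Measurable (f i)
  exists_bound : ∃ M, ∀ i a, ‖f i a‖ ≤ M
  eq_zero_of_notMem : ∀ i, ∀ a ∉ s, f i a = 0
  limit_eq_zero_of_notMem : ∀ a ∉ s, g a = 0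
  ae_tendsto : ∀ᵐ a ∂μ, Filter.Tendsto (f · a) Filter.atTop (nhds (g a))

section Limits

open Filter Topology

variable {α E : Type*} [MeasurableSpace α] [NormedAddCommGroup E] [MeasurableSpace E]
  [BorelSpace E] {μ : Measure α}

lemma TendstoBoundedly.tendsto_lintegral_enorm_rpow {s : Set α} {f : ℕ → α → E} {g : α → E}
    (h : TendstoBoundedly μ s f g) (hs : MeasurableSet s) (hμs : μ s ≠ ∞) {q : ℝ} (hq : 0 < q) :
    Tendsto (fun i => ∫⁻ a, ‖f i a‖ₑ ^ q ∂μ) atTop (𝓝 (∫⁻ a, ‖g a‖ₑ ^ q ∂μ)) ∧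
      ∫⁻ a, ‖g a‖ₑ ^ q ∂μ ≠ ∞ := by
  obtain ⟨M, hM⟩ := h.exists_bound
  let bound : α → ℝ≥0∞ := s.indicator fun _ => ENNReal.ofReal M ^ q
  have hle (i : ℕ) (a : α) : ‖f i a‖ₑ ^ q ≤ bound a := by
    by_cases ha : a ∈ s
    · simp only [bound, Set.indicator_of_mem ha, ← ofReal_norm]
      gcongr
      exact hM i a
    · simp only [h.eq_zero_of_notMem i a ha, enorm_zero, ENNReal.zero_rpow_of_pos hq, zero_le]
  have hlim : ∀ᵐ a ∂μ, Tendsto (fun i => ‖f i a‖ₑ ^ q) atTop (𝓝 (‖g a‖ₑ ^ q)) :=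
    h.ae_tendsto.mono fun a ha => ha.enorm.ennrpow_const q
  have hbound : ∫⁻ a, bound a ∂μ ≠ ∞ := by
    rw [lintegral_indicator_const hs]
    exact ENNReal.mul_ne_top (by finiteness) hμs
  exact ⟨tendsto_lintegral_of_dominated_convergence bound
      (fun i => (h.measurable i).enorm.pow_const q) (fun i => ae_of_all _ (hle i)) hbound hlim,
    ne_top_of_le_ne_top hbound (lintegral_mono_ae
      (hlim.mono fun a ha => le_of_tendsto' ha fun i => hle i a))⟩

lemma TendstoBoundedly.tendsto_const_mul_lintegral_rpow_mul {s : Set α} {f f' : ℕ → α → E}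
    {g g' : α → E} (h : TendstoBoundedly μ s f g) (h' : TendstoBoundedly μ s f' g')
    (hs : MeasurableSet s) (hμs : μ s ≠ ∞) {q r : ℝ} (hq : 0 < q) (hr : 0 ≤ r) {c : ℝ≥0∞}
    (hc : c ≠ ∞) :
    Tendsto (fun i => c * (∫⁻ a, ‖f i a‖ₑ ^ q ∂μ) ^ r * (∫⁻ a, ‖f' i a‖ₑ ^ q ∂μ) ^ r) atTop
      (𝓝 (c * (∫⁻ a, ‖g a‖ₑ ^ q ∂μ) ^ r * (∫⁻ a, ‖g' a‖ₑ ^ q ∂μ) ^ r)) := by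
  obtain ⟨hlim, hfin⟩ := h.tendsto_lintegral_enorm_rpow hs hμs hq
  obtain ⟨hlim', hfin'⟩ := h'.tendsto_lintegral_enorm_rpow hs hμs hq
  exact ENNReal.Tendsto.mul (ENNReal.Tendsto.const_mul (hlim.ennrpow_const r) (Or.inr hc))
    (Or.inr (ENNReal.rpow_ne_top_of_nonneg hr hfin')) (hlim'.ennrpow_const r)
    (Or.inr (ENNReal.mul_ne_top hc (ENNReal.rpow_ne_top_of_nonneg hr hfin)))

lemma sum_lintegral_enorm_rpow_le_of_tendsto {ι : Type*} [Fintype ι] {f : ℕ → ι → α → E}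
    {g : ι → α → E} (hf : ∀ i j, Measurable (f i j))
    (hlim : ∀ j, ∀ᵐ a ∂μ, Tendsto (f · j a) atTop (𝓝 (g j a))) {p : ℝ} {R : ℕ → ℝ≥0∞} {R₀ : ℝ≥0∞}
    (hle : ∀ i, ∑ j, ∫⁻ a, ‖f i j a‖ₑ ^ p ∂μ ≤ R i) (hR : Tendsto R atTop (𝓝 R₀)) :
    ∑ j, ∫⁻ a, ‖g j a‖ₑ ^ p ∂μ ≤ R₀ := by
  have hpow (j : ι) : ∀ᵐ a ∂μ, Tendsto (fun i => ‖f i j a‖ₑ ^ p) atTop (𝓝 (‖g j a‖ₑ ^ p)) :=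
    (hlim j).mono fun a ha => ha.enorm.ennrpow_const p
  have hmeas (i : ℕ) (j : ι) : Measurable fun a => ‖f i j a‖ₑ ^ p := (hf i j).enorm.pow_const p
  calc ∑ j, ∫⁻ a, ‖g j a‖ₑ ^ p ∂μ
      = ∑ j, ∫⁻ a, liminf (fun i => ‖f i j a‖ₑ ^ p) atTop ∂μ :=
        Finset.sum_congr rfl fun j _ =>
          lintegral_congr_ae ((hpow j).mono fun a ha => ha.liminf_eq.symm)
    _ = ∫⁻ a, ∑ j, liminf (fun i => ‖f i j a‖ₑ ^ p) atTop ∂μ :=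
        (lintegral_finsetSum _ fun j _ => Measurable.liminf (hmeas · j)).symm
    _ = ∫⁻ a, liminf (fun i => ∑ j, ‖f i j a‖ₑ ^ p) atTop ∂μ := by
        refine lintegral_congr_ae ((ae_all_iff.2 hpow).mono fun a ha => ?_)
        simp only [(tendsto_finsetSum Finset.univ fun j _ => ha j).liminf_eq, (ha _).liminf_eq]
    _ ≤ liminf (fun i => ∫⁻ a, ∑ j, ‖f i j a‖ₑ ^ p ∂μ) atTop :=
        lintegral_liminf_le fun i => Finset.measurable_fun_sum _ fun j _ => hmeas i j
    _ ≤ liminf R atTop := by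
        refine liminf_le_liminf (Eventually.of_forall fun i => ?_)
        rw [lintegral_finsetSum _ fun j _ => hmeas i j]
        exact hle i
    _ = R₀ := hR.liminf_eq

end Limits

namespace CantorGroup

open Filter Topology

variable {A : Type*} [AddCommGroup A] [Finite A] (e : DigitLabelling A)

lemma ae_restrict_comp_oplus (hd : 1 < Nat.card A) {n : ℕ} {k : ℤ} (hk : -(n : ℤ) ≤ k) {x : ℝ≥0}
    (hx : x < (Nat.card A : ℝ≥0) ^ n) {P : ℝ≥0 → Prop} (hP : ∀ᵐ t ∂halfLineVolume, P t) :
    ∀ᵐ t ∂halfLineVolume.restrict (Set.Iio ((Nat.card A : ℝ≥0) ^ (-k))), P (oplus e x t) := by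
  have hsub : Set.Iio ((Nat.card A : ℝ≥0) ^ (-k)) ⊆ Set.Iio ((Nat.card A : ℝ≥0) ^ n) := by
    refine Set.Iio_subset_Iio ?_
    rw [← zpow_natCast]
    exact zpow_le_zpow_right₀ (by exact_mod_cast hd.le) (neg_le.1 hk)
  exact ae_restrict_of_ae_restrict_of_subset hsub
    ((measurePreserving_oplus e hd hx).quasiMeasurePreserving.ae (ae_restrict_of_ae hP))

lemma ae_tendsto_bilinearAverage (hd : 1 < Nat.card A) {n : ℕ} {k : ℤ} (hk : -(n : ℤ) ≤ k)
    {F' G' : ℕ → ℝ≥0 × ℝ≥0 → ℂ} {F G : ℝ≥0 × ℝ≥0 → ℂ}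
    (hF : TendstoBoundedly quarterPlaneVolume (square (Nat.card A) n) F' F)
    (hG : TendstoBoundedly quarterPlaneVolume (square (Nat.card A) n) G' G) :
    ∀ᵐ z ∂quarterPlaneVolume, Tendsto (fun i => bilinearAverage e k (F' i) (G' i) z) atTop
      (𝓝 (bilinearAverage e k F G z)) := by
  have hFsections : ∀ᵐ y ∂halfLineVolume, ∀ᵐ x ∂halfLineVolume,
      Tendsto (fun i => F' i (x, y)) atTop (𝓝 (F (x, y))) :=
    Measure.ae_ae_of_ae_prod
      (Measure.measurePreserving_swap.quasiMeasurePreserving.ae hF.ae_tendsto)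
  have hGsections : ∀ᵐ x ∂halfLineVolume, ∀ᵐ y ∂halfLineVolume,
      Tendsto (fun i => G' i (x, y)) atTop (𝓝 (G (x, y))) :=
    Measure.ae_ae_of_ae_prod hG.ae_tendsto
  have hfin : IsFiniteMeasure (halfLineVolume.restrict (Set.Iio ((Nat.card A : ℝ≥0) ^ (-k)))) :=
    ⟨by rw [Measure.restrict_apply_univ, halfLineVolume_Iio]; exact ENNReal.coe_lt_top⟩
  obtain ⟨M, hM⟩ := hF.exists_bound
  obtain ⟨N, hN⟩ := hG.exists_bound
  filter_upwards [Measure.quasiMeasurePreserving_snd.ae hFsections,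
    Measure.quasiMeasurePreserving_fst.ae hGsections] with z hFz hGz
  by_cases hz : z ∈ square (Nat.card A) n
  swap
  · simp only [bilinearAverage_eq_zero_of_notMem_square e (hF.eq_zero_of_notMem _)
      (hG.eq_zero_of_notMem _) k hz, bilinearAverage_eq_zero_of_notMem_square e
      hF.limit_eq_zero_of_notMem hG.limit_eq_zero_of_notMem k hz, tendsto_const_nhds]
  simp only [bilinearAverage, Ico_zero_eq_Iio]
  refine Tendsto.const_mul _ (tendsto_integral_of_dominated_convergence (fun _ => M * N)
    (fun i => ?_) (integrable_const _) (fun i => ae_of_all _ fun t => ?_) ?_)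
  · exact (((hF.measurable i).comp ((measurable_oplus e _).prodMk measurable_const)).mul
      ((hG.measurable i).comp (measurable_const.prodMk
        (measurable_oplus e _)))).aestronglyMeasurable
  · exact norm_mul_le_of_le (hM i _) (hN i _)
  · filter_upwards [ae_restrict_comp_oplus e hd hk hz.1 hFz,
      ae_restrict_comp_oplus e hd hk hz.2 hGz] with t hFt hGt
    exact hFt.mul hGt

end CantorGroup

section Grids

open Filter Topology

variable {d : ℕ}

/-- The indices of the square of side `d⁻ⁿ` in the grid of the quarter-plane that contains a given
point. -/
def gridMap (d n : ℕ) (z : ℝ≥0 × ℝ≥0) : ℕ × ℕ :=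
  (⌊(d : ℝ≥0) ^ n * z.1⌋₊, ⌊(d : ℝ≥0) ^ n * z.2⌋₊)

lemma measurable_gridMap (d n : ℕ) : Measurable (gridMap d n) :=
  (Nat.measurable_floor.comp (measurable_fst.const_mul _)).prodMk
    (Nat.measurable_floor.comp (measurable_snd.const_mul _))

/-- The filtration of the quarter-plane that is generated by the grids of side `d⁻ⁿ`. -/
def gridFiltration (hd : 0 < d) :
    Filtration ℕ (inferInstance : MeasurableSpace (ℝ≥0 × ℝ≥0)) where
  seq n := MeasurableSpace.comap (gridMap d n) inferInstance
  mono' := monotone_nat_of_le_succ fun n => by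
    have hcoarsen : gridMap d n = (fun a : ℕ × ℕ => (a.1 / d ^ 1, a.2 / d ^ 1)) ∘
        gridMap d (n + 1) := by
      funext z
      simp only [gridMap, Function.comp_apply, floor_pow_add_mul_div_pow hd]
    rw [hcoarsen, ← MeasurableSpace.comap_comp]
    exact MeasurableSpace.comap_mono (measurable_of_countable _).comap_le
  le' n := (measurable_gridMap d n).comap_le

lemma iSup_gridFiltration (hd : 1 < d) :
    ⨆ n, gridFiltration (Nat.zero_lt_of_lt hd) n
      = (inferInstance : MeasurableSpace (ℝ≥0 × ℝ≥0)) := by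
  refine le_antisymm (iSup_le fun n => (gridFiltration _).le n) ?_
  have hgrid (n : ℕ) :
      Measurable[⨆ n, gridFiltration (Nat.zero_lt_of_lt hd) n] (gridMap d n) :=
    (comap_measurable (gridMap d n)).mono
      (le_iSup (fun n => gridFiltration (Nat.zero_lt_of_lt hd) n) n) le_rfl
  have hlimit {u : ℝ≥0 × ℝ≥0 → ℝ≥0} {v : ℕ × ℕ → ℕ}
      (huv : ∀ n z, v (gridMap d n z) = ⌊(d : ℝ≥0) ^ n * u z⌋₊) :
      Measurable[⨆ n, gridFiltration (Nat.zero_lt_of_lt hd) n] u :=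
    @measurable_of_tendsto_metrizable _ _ (⨆ n, gridFiltration (Nat.zero_lt_of_lt hd) n) _ _ _ _
      (fun n z => (v (gridMap d n z) : ℝ≥0) / (d : ℝ≥0) ^ n) _
      (fun n => (measurable_of_countable
        (fun a : ℕ × ℕ => (v a : ℝ≥0) / (d : ℝ≥0) ^ n)).comp (hgrid n))
      (tendsto_pi_nhds.2 fun z => by simpa only [huv] using tendsto_floor_div_pow hd (u z))
  exact sup_le (hlimit (v := Prod.fst) fun _ _ => rfl).comap_le
    (hlimit (v := Prod.snd) fun _ _ => rfl).comap_le

lemma exists_grid_approximation_real (hd : 1 < d) (μ : Measure (ℝ≥0 × ℝ≥0))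
    [IsFiniteMeasure μ] {F : ℝ≥0 × ℝ≥0 → ℝ} (hF : Measurable F) {M : ℝ} (hM : ∀ z, |F z| ≤ M) :
    ∃ φ : ℕ → ℕ × ℕ → ℝ, (∀ n a, |φ n a| ≤ M) ∧
      ∀ᵐ z ∂μ, Tendsto (fun n => φ n (gridMap d n z)) atTop (𝓝 (F z)) := by
  let ℱ := gridFiltration (Nat.zero_lt_of_lt hd)
  have hfactor (n : ℕ) : ∃ φ : ℕ × ℕ → ℝ, Measurable φ ∧ μ[F | ℱ n] = φ ∘ gridMap d n :=
    (stronglyMeasurable_condExp (m := ℱ n)).measurable.exists_eq_measurable_comp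
  choose φ _ hφ using hfactor
  have hM₀ : -M ≤ M := (neg_le_self ((abs_nonneg _).trans (hM 0)))
  have hclamp {x : ℝ} (hx : |x| ≤ M) : max (-M) (min x M) = x := by
    rw [min_eq_left (abs_le.1 hx).2, max_eq_right (abs_le.1 hx).1]
  refine ⟨fun n a => max (-M) (min (φ n a) M), fun n a => abs_le.2 ⟨le_max_left _ _,
    max_le hM₀ (min_le_right _ _)⟩, ?_⟩
  have hint : Integrable F μ := Integrable.of_bound hF.aestronglyMeasurable M (ae_of_all _ hM)
  have hlimit_measurable : StronglyMeasurable[⨆ n, ℱ n] F := by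
    rw [iSup_gridFiltration hd]
    exact hF.stronglyMeasurable
  filter_upwards [hint.tendsto_ae_condExp hlimit_measurable] with z hz
  simp only [hφ, Function.comp_apply] at hz
  rw [← hclamp (hM z)]
  exact tendsto_const_nhds.max (hz.min tendsto_const_nhds)

lemma exists_grid_approximation (hd : 1 < d) (μ : Measure (ℝ≥0 × ℝ≥0))
    [IsFiniteMeasure μ] {F : ℝ≥0 × ℝ≥0 → ℂ} (hF : Measurable F) {M : ℝ} (hM : ∀ z, ‖F z‖ ≤ M) :
    ∃ φ : ℕ → ℕ × ℕ → ℂ, (∀ n a, ‖φ n a‖ ≤ M + M) ∧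
      ∀ᵐ z ∂μ, Tendsto (fun n => φ n (gridMap d n z)) atTop (𝓝 (F z)) := by
  obtain ⟨φ, hφM, hφ⟩ := exists_grid_approximation_real hd μ (Complex.measurable_re.comp hF)
    fun z => (Complex.abs_re_le_norm _).trans (hM z)
  obtain ⟨ψ, hψM, hψ⟩ := exists_grid_approximation_real hd μ (Complex.measurable_im.comp hF)
    fun z => (Complex.abs_im_le_norm _).trans (hM z)
  refine ⟨fun n a => φ n a + ψ n a * Complex.I, fun n a => norm_add_le_of_le ?_ ?_, ?_⟩
  · rw [Complex.norm_real]
    exact hφM n a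
  · rw [norm_mul, Complex.norm_I, mul_one, Complex.norm_real]
    exact hψM n a
  · filter_upwards [hφ, hψ] with z hφz hψz
    rw [← Complex.re_add_im (F z)]
    exact hφz.ofReal.add (hψz.ofReal.mul_const Complex.I)

end Grids

lemma measurableSet_square (d n : ℕ) : MeasurableSet (square d n) :=
  measurableSet_Iio.prod measurableSet_Iio

lemma quarterPlaneVolume_square_ne_top (d n : ℕ) : quarterPlaneVolume (square d n) ≠ ∞ := by
  rw [square, quarterPlaneVolume, Measure.prod_prod, halfLineVolume_Iio]
  exact ENNReal.mul_ne_top ENNReal.coe_ne_top ENNReal.coe_ne_top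

namespace CantorGroup

variable {A : Type*} [AddCommGroup A] [Finite A] (e : DigitLabelling A)

open Classical in
lemma indicator_square_comp_gridMap (hd : 1 < Nat.card A) {n₀ n : ℕ} (hn : n₀ ≤ n)
    (φ : ℕ × ℕ → ℂ) :
    (square (Nat.card A) n₀).indicator (fun z => φ (gridMap (Nat.card A) n z))
      = stepFun e n fun h =>
        if h.1 ∈ blockSubgroup A n (-n₀) ∧ h.2 ∈ blockSubgroup A n (-n₀) then
          φ (cellIndex e n h.1, cellIndex e n h.2) else 0 := by
  funext z
  have hle : (Nat.card A : ℝ≥0) ^ n₀ ≤ (Nat.card A : ℝ≥0) ^ n :=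
    pow_le_pow_right₀ (by exact_mod_cast hd.le) hn
  by_cases hz : z ∈ square (Nat.card A) n
  · have hmem {t : ℝ≥0} (ht : t < (Nat.card A : ℝ≥0) ^ n) :
        digits e n t ∈ blockSubgroup A n (-n₀) ↔ t < (Nat.card A : ℝ≥0) ^ n₀ := by
      rw [digits_mem_blockSubgroup_iff e hd (by lia) ht, neg_neg, zpow_natCast]
    simp only [stepFun, Set.indicator_of_mem hz, hmem hz.1.out, hmem hz.2.out,
      cellIndex_digits e hz.1.out, cellIndex_digits e hz.2.out]
    exact if_congr Iff.rfl rfl rfl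
  · rw [stepFun_of_notMem e _ hz, Set.indicator_of_notMem fun h =>
      hz ⟨h.1.out.trans_le hle, h.2.out.trans_le hle⟩]

lemma exists_stepFun_tendstoBoundedly (hd : 1 < Nat.card A) {F : ℝ≥0 × ℝ≥0 → ℂ}
    (hF : Measurable F) {M : ℝ} (hM : ∀ z, ‖F z‖ ≤ M) {n₀ : ℕ}
    (hsupp : ∀ z ∉ square (Nat.card A) n₀, F z = 0) :
    ∃ f : ∀ i, (Fin (2 * (i + n₀)) → A) × (Fin (2 * (i + n₀)) → A) → ℂ,
      TendstoBoundedly quarterPlaneVolume (square (Nat.card A) n₀)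
        (fun i => stepFun e (i + n₀) (f i)) F := by
  have hfin : IsFiniteMeasure (quarterPlaneVolume.restrict (square (Nat.card A) n₀)) :=
    ⟨by rw [Measure.restrict_apply_univ]; exact (quarterPlaneVolume_square_ne_top _ n₀).lt_top⟩
  obtain ⟨φ, hφM, hφ⟩ := exists_grid_approximation hd
    (quarterPlaneVolume.restrict (square (Nat.card A) n₀)) hF hM
  have hstep (i : ℕ) : ∃ f, (square (Nat.card A) n₀).indicator
      (fun z => φ (i + n₀) (gridMap (Nat.card A) (i + n₀) z)) = stepFun e (i + n₀) f :=
    ⟨_, indicator_square_comp_gridMap e hd (Nat.le_add_left n₀ i) _⟩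
  choose f hf using hstep
  refine ⟨f, fun i => measurable_stepFun e _, ⟨M + M, fun i z => ?_⟩, fun i z hz => ?_, hsupp, ?_⟩
  · rw [← hf]
    exact (norm_indicator_le_norm_self _ _).trans (hφM _ _)
  · rw [← hf, Set.indicator_of_notMem hz]
  · simp only [← hf]
    rw [ae_restrict_iff' (measurableSet_square _ n₀)] at hφ
    filter_upwards [hφ] with z hz
    by_cases hzs : z ∈ square (Nat.card A) n₀
    · simp only [Set.indicator_of_mem hzs]
      exact (hz hzs).comp (Filter.tendsto_add_atTop_nat n₀)
    · simp only [Set.indicator_of_notMem hzs, hsupp z hzs, tendsto_const_nhds]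

end CantorGroup

lemma eLpNorm_ofReal_rpow {α E : Type*} [MeasurableSpace α] [NormedAddCommGroup E] {μ : Measure α}
    {q : ℝ} (hq : 0 < q) (r : ℝ) (f : α → E) :
    eLpNorm f (ENNReal.ofReal q) μ ^ r = (∫⁻ a, ‖f a‖ₑ ^ q ∂μ) ^ (r / q) := by
  rw [eLpNorm_eq_lintegral_rpow_enorm_toReal (ENNReal.ofReal_pos.2 hq).ne' ENNReal.ofReal_ne_top,
    ENNReal.toReal_ofReal hq.le, ← ENNReal.rpow_mul, one_div_mul_eq_div]

lemma exists_forall_notMem_square_eq_zero {d : ℕ} (hd : 1 < d) {E : Type*} [Zero E]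
    {F : ℝ≥0 × ℝ≥0 → E} {a b : ℝ≥0 × ℝ≥0} (hF : Function.support F ⊆ Set.Icc a b) :
    ∃ n₀ : ℕ, ∀ n ≥ n₀, ∀ z ∉ square d n, F z = 0 := by
  have hd₁ : (1 : ℝ≥0) < d := by exact_mod_cast hd
  obtain ⟨n₀, hn₀⟩ := pow_unbounded_of_one_lt (max b.1 b.2) hd₁
  refine ⟨n₀, fun n hn z hz => not_not.1 fun hne => hz ?_⟩
  have hzb : z ≤ b := (hF hne).2
  have hlt := hn₀.trans_le (pow_le_pow_right₀ hd₁.le hn)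
  exact ⟨(hzb.1.trans (le_max_left _ _)).trans_lt hlt,
    (hzb.2.trans (le_max_right _ _)).trans_lt hlt⟩

namespace CantorGroup

open Filter Topology

variable {A : Type*} [AddCommGroup A] [Finite A] (e : DigitLabelling A)

lemma measurable_bilinearAverage_stepFun (hd : 1 < Nat.card A) {n : ℕ} {k : ℤ}
    (hk : k ∈ Set.Icc (-n : ℤ) n) (f g : (Fin (2 * n) → A) × (Fin (2 * n) → A) → ℂ) :
    Measurable (bilinearAverage e k (stepFun e n f) (stepFun e n g)) := by
  cases nonempty_fintype A
  rw [bilinearAverage_stepFun e hd hk]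
  exact measurable_stepFun e _

theorem lintegral_variation_le (hd : 1 < Nat.card A) {p : ℝ} (hp : 2 ≤ p) {m : ℕ}
    {k : Fin (m + 1) → ℤ} (hk : Monotone k) {n : ℕ} (hkn : ∀ j, k j ∈ Set.Icc (-n : ℤ) n)
    {F G : ℝ≥0 × ℝ≥0 → ℂ} (hF : Measurable F) (hG : Measurable G) {M N : ℝ}
    (hFM : ∀ z, ‖F z‖ ≤ M) (hGN : ∀ z, ‖G z‖ ≤ N)
    (hF₀ : ∀ z ∉ square (Nat.card A) n, F z = 0) (hG₀ : ∀ z ∉ square (Nat.card A) n, G z = 0) :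
    ∑ j : Fin m, ∫⁻ z, ‖bilinearAverage e (k j.succ) F G z
        - bilinearAverage e (k j.castSucc) F G z‖ₑ ^ p ∂quarterPlaneVolume
      ≤ ENNReal.ofReal (2 ^ (p - 2) * 3)
        * (∫⁻ z, ‖F z‖ₑ ^ (2 * p) ∂quarterPlaneVolume) ^ (1 / 2 : ℝ)
        * (∫⁻ z, ‖G z‖ₑ ^ (2 * p) ∂quarterPlaneVolume) ^ (1 / 2 : ℝ) := by
  obtain ⟨f, hf⟩ := exists_stepFun_tendstoBoundedly e hd hF hFM hF₀
  obtain ⟨g, hg⟩ := exists_stepFun_tendstoBoundedly e hd hG hGN hG₀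
  have hkn' (i : ℕ) (j : Fin (m + 1)) :
      k j ∈ Set.Icc (-(i + n : ℕ) : ℤ) (i + n : ℕ) := by
    have := hkn j
    simp only [Set.mem_Icc] at this ⊢
    lia
  have hlim (j : Fin (m + 1)) := ae_tendsto_bilinearAverage e hd (hkn j).1 hf hg
  have hR := hf.tendsto_const_mul_lintegral_rpow_mul hg (measurableSet_square _ n)
    (quarterPlaneVolume_square_ne_top _ n) (show 0 < 2 * p by linarith)
    (show (0 : ℝ) ≤ 1 / 2 by norm_num) (ENNReal.ofReal_ne_top (r := 2 ^ (p - 2) * 3))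
  let T (i : ℕ) (j : Fin (m + 1)) :=
    bilinearAverage e (k j) (stepFun e (i + n) (f i)) (stepFun e (i + n) (g i))
  have hT (i : ℕ) (j : Fin (m + 1)) : Measurable (T i j) :=
    measurable_bilinearAverage_stepFun e hd (hkn' i j) (f i) (g i)
  have hdiff (i : ℕ) (j : Fin m) : Measurable fun z => T i j.succ z - T i j.castSucc z :=
    (hT i j.succ).sub (hT i j.castSucc)
  have hdiff_lim (j : Fin m) : ∀ᵐ z ∂quarterPlaneVolume,
      Tendsto (fun i => T i j.succ z - T i j.castSucc z) atTop
        (𝓝 (bilinearAverage e (k j.succ) F G z - bilinearAverage e (k j.castSucc) F G z)) := by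
    filter_upwards [hlim j.succ, hlim j.castSucc] with z hsucc hcastSucc
    exact hsucc.sub hcastSucc
  exact sum_lintegral_enorm_rpow_le_of_tendsto hdiff hdiff_lim
    (fun i => lintegral_variation_stepFun_le e hd hp hk (hkn' i) (f i) (g i)) hR

lemma bilinearAverage_eq_of_card_eq_one (hA : Nat.card A = 1) (k l : ℤ) (F G : ℝ≥0 × ℝ≥0 → ℂ) :
    bilinearAverage e k F G = bilinearAverage e l F G := by
  funext z
  simp only [bilinearAverage, hA, Nat.cast_one, one_zpow]

theorem sum_eLpNorm_variation_le {p : ℝ} (hp : 2 ≤ p) {F G : ℝ≥0 × ℝ≥0 → ℂ} (hF : Measurable F)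
    (hG : Measurable G) {M N : ℝ} (hFM : ∀ z, ‖F z‖ ≤ M) (hGN : ∀ z, ‖G z‖ ≤ N)
    {a b a' b' : ℝ≥0 × ℝ≥0} (hFsupp : Function.support F ⊆ Set.Icc a b)
    (hGsupp : Function.support G ⊆ Set.Icc a' b') {m : ℕ} {k : Fin (m + 1) → ℤ}
    (hk : Monotone k) :
    ∑ j : Fin m, eLpNorm (bilinearAverage e (k j.succ) F G - bilinearAverage e (k j.castSucc) F G)
        (ENNReal.ofReal p) quarterPlaneVolume ^ p
      ≤ ENNReal.ofReal (2 ^ (p - 2) * 3)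
        * eLpNorm F (ENNReal.ofReal (2 * p)) quarterPlaneVolume ^ p
        * eLpNorm G (ENNReal.ofReal (2 * p)) quarterPlaneVolume ^ p := by
  have hp₀ : 0 < p := by linarith
  rcases (Nat.one_le_iff_ne_zero.2 (Nat.card_pos (α := A)).ne').eq_or_lt with hA | hd
  · simp only [bilinearAverage_eq_of_card_eq_one e hA.symm _ 0, sub_self, eLpNorm_zero,
      ENNReal.zero_rpow_of_pos hp₀, Finset.sum_const_zero, zero_le]
  obtain ⟨n₁, hn₁⟩ := exists_forall_notMem_square_eq_zero hd hFsupp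
  obtain ⟨n₂, hn₂⟩ := exists_forall_notMem_square_eq_zero hd hGsupp
  let n := n₁ + n₂ + ∑ j, (k j).natAbs
  have hkn (j : Fin (m + 1)) : k j ∈ Set.Icc (-n : ℤ) n := by
    have := Finset.single_le_sum (f := fun i => (k i).natAbs) (fun _ _ => Nat.zero_le _)
      (Finset.mem_univ j)
    simp only [Set.mem_Icc]
    lia
  have hhalf : p / (2 * p) = 1 / 2 := by field
  simp only [eLpNorm_ofReal_rpow hp₀, eLpNorm_ofReal_rpow (mul_pos two_pos hp₀), hhalf,
    div_self hp₀.ne', ENNReal.rpow_one]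
  exact lintegral_variation_le e hd hp hk hkn hF hG hFM hGN (hn₁ n (by lia)) (hn₂ n (by lia))

end CantorGroup

end

theorem mainTheorem2 (p : ℝ) (hp : 2 ≤ p) :
    ∃ C : ℝ≥0, ∀ (A : Type*) [AddCommGroup A] [Finite A] (e : DigitLabelling A)
      (F G : ℝ≥0 × ℝ≥0 → ℂ),
      Measurable F → Measurable G →
      (∃ M : ℝ, ∀ z, ‖F z‖ ≤ M) → (∃ M : ℝ, ∀ z, ‖G z‖ ≤ M) →
      -- the supports lie in bounded rectangles `[a₁, b₁] × [a₂, b₂]`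
      (∃ a b : ℝ≥0 × ℝ≥0, Function.support F ⊆ Set.Icc a b) →
      (∃ a b : ℝ≥0 × ℝ≥0, Function.support G ⊆ Set.Icc a b) →
      ∀ (m : ℕ), 0 < m → ∀ k : Fin (m + 1) → ℤ, StrictMono k →
        ∑ j : Fin m,
          eLpNorm (CantorGroup.bilinearAverage e (k j.succ) F G
              - CantorGroup.bilinearAverage e (k j.castSucc) F G)
            (ENNReal.ofReal p) quarterPlaneVolume ^ p
        ≤ (C : ℝ≥0∞) * eLpNorm F (ENNReal.ofReal (2 * p)) quarterPlaneVolume ^ p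
            * eLpNorm G (ENNReal.ofReal (2 * p)) quarterPlaneVolume ^ p := by
  refine ⟨(2 ^ (p - 2) * 3 : ℝ).toNNReal, ?_⟩
  intro A _ _ e F G hF hG ⟨M, hM⟩ ⟨N, hN⟩ ⟨a, b, hFsupp⟩ ⟨a', b', hGsupp⟩ m _ k hk
  exact CantorGroup.sum_eLpNorm_variation_le e hp hF hG hM hN hFsupp hGsupp hk.monotone
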